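/- Let $M$ be a Riemannian surface, that is, a smooth two-dimensional manifold without boundary (Hausdorff, second countable, not necessarily complete) with a smooth Riemannian metric. A domain $\Omega\subset M$ (open, connected, non-empty) is called admissible if $\overline\Omega$ is compact; $\Omega$ is geodesically convex, i.e. any two points of $\Omega$ can be joined by a minimizing geodesic of $M$ contained in $\Omega$; and $\partial\Omega\neq\varnothing$ is the union of finitely many geodesic arcs $A_1,\dots,A_s,B_1,\dots,B_r$ and finitely many arcs $C_1,\dots,C_t$ that are convex with respect to $\Omega$ (each interior point of $C_k$ has a neighbourhood $U$ such that every minimizing geodesic of $M$ joining two points of $\Omega\cap U$ lies in $\Omega$), together with the end points of these arcs, where no two of the arcs $A_i$ and no two of the arcs $B_j$ have a common end point. Let $\Omega\subset M$ be an admissible domain and let $u_1,u_2\colon\Omega\to\mathbb{R}$ be functions of class $C^2$ such that $$\operatorname{div}\left(\frac{\nabla u_1}{\sqrt{1+|\nabla u_1|^2}}\right)\ \geq\ \operatorname{div}\left(\frac{\nabla u_2}{\sqrt{1+|\nabla u_2|^2}}\right)\quad\text{in }\Omega .$$ Suppose that there is a finite set $E\subset\partial\Omega$ such that $\liminf_{x\to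 p,\ x\in\Omega}\,(u_2(x)-u_1(x))\geq 0$ for every $p\in\partial\Omega\setminus E$. Then $u_2\geq u_1$ in $\Omega$; moreover, either $u_2>u_1$ everywhere in $\Omega$, or $u_2=u_1$ everywhere in $\Omega$. -/

import Mathlib

open Set Filter Topology Manifold ContDiff Bundle

noncomputable section

namespace MeanCurv

/-- The Euclidean plane, on which surfaces are modelled. -/
abbrev Plane : Type := EuclideanSpace ℝ (Fin 2)

section Divergence

variable {M : Type*} [TopologicalSpace M] [ChartedSpace Plane M] [IsManifold (𝓡 2) ∞ M]
  [RiemannianBundle (fun x : M => TangentSpace (𝓡 2) x)]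

/-- The Riemannian gradient of `u` at `x`: the vector `v` with `⟪v, w⟫ = du_x(w)` for all `w`. -/
def grad (u : M → ℝ) (x : M) : TangentSpace (𝓡 2) x :=
  haveI : FiniteDimensional ℝ (TangentSpace (𝓡 2) x) :=
    inferInstanceAs (FiniteDimensional ℝ Plane)
  haveI : CompleteSpace (TangentSpace (𝓡 2) x) := FiniteDimensional.complete ℝ _
  (InnerProductSpace.toDual ℝ (TangentSpace (𝓡 2) x)).symm (mfderiv (𝓡 2) 𝓘(ℝ, ℝ) u x)

/-- The coordinate vector field `∂_i` of the preferred chart at `p`, at the point of `M` whose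
coordinates in that chart are `y`. -/
def coordVec (p : M) (y : Plane) (i : Fin 2) :
    TangentSpace (𝓡 2) ((extChartAt (𝓡 2) p).symm y) :=
  mfderiv 𝓘(ℝ, Plane) (𝓡 2) (extChartAt (𝓡 2) p).symm y (EuclideanSpace.single i (1 : ℝ))

/-- The Riemannian volume density `√(det (g_ij))` in the preferred chart at `p`, as a function of
the coordinates. -/
def volDensity (p : M) (y : Plane) : ℝ :=
  √((Matrix.of fun i j : Fin 2 => inner ℝ (coordVec p y i) (coordVec p y j)).det)

/-- The components `X^1, X^2` of the vector field `X` in the preferred chart at `p`, as functions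
of the coordinates. -/
def coordComp (X : ∀ x : M, TangentSpace (𝓡 2) x) (p : M) (y : Plane) : Plane :=
  mfderiv (𝓡 2) 𝓘(ℝ, Plane) (extChartAt (𝓡 2) p) ((extChartAt (𝓡 2) p).symm y)
    (X ((extChartAt (𝓡 2) p).symm y))

/-- The Riemannian divergence of a vector field `X` at `p`, by the classical formula
`div X = (det g)^(-1/2) ∑ i, ∂_i ((det g)^(1/2) X^i)` in the preferred chart at `p`
(for a differentiable field the value of this expression does not depend on the chart). -/
def divergence (X : ∀ x : M, TangentSpace (𝓡 2) x) (p : M) : ℝ :=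
  (volDensity p (extChartAt (𝓡 2) p p))⁻¹ *
    ∑ i : Fin 2, fderiv ℝ (fun y : Plane => volDensity p y * coordComp X p y i)
      (extChartAt (𝓡 2) p p) (EuclideanSpace.single i (1 : ℝ))

/-- The mean curvature operator `div (∇u / √(1 + |∇u|²))`. -/
def meanCurvOp (u : M → ℝ) : M → ℝ :=
  divergence fun x => (√(1 + ‖grad u x‖ ^ 2))⁻¹ • grad u x

end Divergence

section Domains

variable {M : Type*} [TopologicalSpace M] [ChartedSpace Plane M]
  [RiemannianBundle (fun x : M => TangentSpace (𝓡 2) x)]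

/-- `γ` restricted to `[0,1]` is a minimizing geodesic of `M` from `x` to `y`, parametrized
proportionally to arc length. -/
def IsMinGeodesic (γ : ℝ → M) (x y : M) : Prop :=
  ContinuousOn γ (Icc 0 1) ∧ γ 0 = x ∧ γ 1 = y ∧
    ∀ s ∈ Icc (0 : ℝ) 1, ∀ t ∈ Icc (0 : ℝ) 1,
      riemannianEDist (𝓡 2) (γ s) (γ t) = ENNReal.ofReal |s - t| * riemannianEDist (𝓡 2) x y

/-- Any two points of `Ω` are joined by a minimizing geodesic of `M` that is contained in `Ω`. -/
def GeodesicallyConvex (Ω : Set M) : Prop :=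
  ∀ x ∈ Ω, ∀ y ∈ Ω, ∃ γ : ℝ → M, IsMinGeodesic γ x y ∧ MapsTo γ (Icc 0 1) Ω

/-- `γ` restricted to `[0,1]` parametrizes an arc with end points `γ 0` and `γ 1`: it is
continuous and injective, except that the two end points are allowed to coincide. -/
def IsArc (γ : ℝ → M) : Prop :=
  ContinuousOn γ (Icc 0 1) ∧ InjOn γ (Ico 0 1) ∧ InjOn γ (Ioc 0 1)

/-- A geodesic arc: an arc which, parametrized with constant speed `v > 0`, is locally length
minimizing. -/
def IsGeodesicArc (γ : ℝ → M) : Prop :=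
  IsArc γ ∧ ∃ v : ℝ, 0 < v ∧ ∀ t ∈ Icc (0 : ℝ) 1, ∃ δ > 0,
    ∀ a ∈ Icc (0 : ℝ) 1 ∩ Ioo (t - δ) (t + δ), ∀ b ∈ Icc (0 : ℝ) 1 ∩ Ioo (t - δ) (t + δ),
      riemannianEDist (𝓡 2) (γ a) (γ b) = ENNReal.ofReal (v * |a - b|)

/-- An arc that is convex with respect to the domain `Ω`: each of its interior points has a
neighbourhood `U` such that the minimizing geodesics of `M` joining two points of `Ω ∩ U` stay
in `Ω`. -/
def IsConvexArc (Ω : Set M) (γ : ℝ → M) : Prop :=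
  IsArc γ ∧ ∀ t ∈ Ioo (0 : ℝ) 1, ∃ U ∈ 𝓝 (γ t), ∀ x ∈ Ω ∩ U, ∀ y ∈ Ω ∩ U,
    ∀ σ : ℝ → M, IsMinGeodesic σ x y → MapsTo σ (Icc 0 1) Ω

/-- The arcs `α` and `β` have no common end point. -/
def NoCommonEndpoint (α β : ℝ → M) : Prop :=
  Disjoint ({α 0, α 1} : Set M) {β 0, β 1}

/-- Admissible domains: relatively compact, geodesically convex domains whose (non-empty) boundary
is the union of finitely many geodesic arcs `A i`, `B j` and finitely many arcs `C k` convex with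
respect to `Ω`, together with their end points, no two of the `A i` and no two of the `B j` having
a common end point. -/
structure IsAdmissible (Ω : Set M) : Prop where
  isOpen : IsOpen Ω
  isConnected : IsConnected Ω
  isCompact_closure : IsCompact (closure Ω)
  geodesicallyConvex : GeodesicallyConvex Ω
  frontier_nonempty : (frontier Ω).Nonempty
  frontier_arcs : ∃ (s r t : ℕ) (A : Fin s → ℝ → M) (B : Fin r → ℝ → M) (C : Fin t → ℝ → M),
    (∀ i, IsGeodesicArc (A i)) ∧ (∀ j, IsGeodesicArc (B j)) ∧ (∀ k, IsConvexArc Ω (C k)) ∧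
    frontier Ω = (⋃ i, A i '' Icc 0 1) ∪ (⋃ j, B j '' Icc 0 1) ∪ (⋃ k, C k '' Icc 0 1) ∧
    (∀ i i', i ≠ i' → NoCommonEndpoint (A i) (A i')) ∧
    (∀ j j', j ≠ j' → NoCommonEndpoint (B j) (B j'))

end Domains

end MeanCurv

end

/-! Put w = u₁ - u₂ and let X be the difference of the fields ∇uᵢ/√(1+|∇uᵢ|²). Three facts drive the
proof: |X| ≤ 2 whatever the gradients are; ⟨∇w, X⟩ ≥ 0, with equality only where ∇u₁ = ∇u₂
(`inner_sub_normalized_eq`); and div X ≥ 0 by hypothesis.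

Weak inequality. Fix ε > 0, a smooth bounded nondecreasing f vanishing exactly on (-∞, ε], and a
cutoff η vanishing near E. The set {w ≥ ε} can approach ∂Ω only at E, so η f(w) is a compactly
supported C¹ test function in Ω (`isCompact_superlevel_diff`), and div X ≥ 0 gives ∫ η f'(w)⟨∇w, X⟩
≤ -∫ f(w) dη(X). A cutoff at scale δ has gradient of order 1/δ on a set of area of order δ²; since X
and f are bounded, the right-hand side can be made arbitrarily small (`exists_cutoff_finite`,
`exists_integrable_lower_bound`). Hence ∇w = 0 wherever w > 0 (`diffAt_eq_of_pos`). If w were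
positive somewhere, it would be a positive constant on the connected set Ω, which contradicts the
liminf condition at a boundary point outside E; such a point exists because ∂Ω contains an arc
(`le_of_liminf_nonneg`).

Strict alternative. In a chart, u₂ - u₁ ≥ 0 is a supersolution of a linear elliptic operator with
explicit coefficients `linCoeff` and no zeroth order term. Hopf's boundary point argument shows that
its zero set is open (`eventually_eq_of_le_of_eq`). The zero set is also closed in Ω, so it is empty
or all of Ω.

The geometric input is that the divergence may be computed in any chart (`divergence_eq_chart`) and
that the area measures of the charts glue to one measure (`exists_isRiemannianMeasure`). -/

noncomputable section

namespace MeanCurv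

/-! ### Hopf's boundary point argument and the strong minimum principle in the plane. -/

section StrongMinimum

/-- At a local minimum the Hessian is positive semidefinite. -/
theorem hessian_nonneg_of_isLocalMin {w : Plane → ℝ} {x : Plane} (hw : ContDiffAt ℝ 2 w x)
    (hmin : IsLocalMin w x) (v : Plane) : 0 ≤ fderiv ℝ (fderiv ℝ w) x v v := by
  have hev : ∀ᶠ y in 𝓝 x, DifferentiableAt ℝ w y := by
    have := hw.eventually (by simp)
    filter_upwards [this] with y hy using hy.differentiableAt (by simp)
  have hd2 : DifferentiableAt ℝ (fderiv ℝ w) x :=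
    (hw.fderiv_right (m := 1) (by norm_num)).differentiableAt (by simp)
  let ℓ : ℝ → Plane := fun t => x + t • v
  have hℓ : ∀ t, HasDerivAt ℓ v t := fun t => by
    have := ((hasDerivAt_id t).smul_const v).const_add x
    rwa [one_smul] at this
  have hℓ0 : ℓ 0 = x := by simp [ℓ]
  have hℓc : Tendsto ℓ (𝓝 0) (𝓝 x) := by
    have := (hℓ 0).continuousAt.tendsto
    rwa [hℓ0] at this
  have hd1 : ∀ᶠ t in 𝓝 (0 : ℝ), HasDerivAt (fun t => w (ℓ t)) (fderiv ℝ w (ℓ t) v) t := by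
    filter_upwards [hℓc.eventually hev] with t ht
    exact ht.hasFDerivAt.comp_hasDerivAt t (hℓ t)
  have hderiv : deriv (fun t => w (ℓ t)) =ᶠ[𝓝 0] fun t => fderiv ℝ w (ℓ t) v := by
    filter_upwards [hd1] with t ht using ht.deriv
  have hdd : HasDerivAt (fun t => fderiv ℝ w (ℓ t) v) (fderiv ℝ (fderiv ℝ w) x v v) 0 := by
    have h1 : HasDerivAt (fun t => fderiv ℝ w (ℓ t)) (fderiv ℝ (fderiv ℝ w) x v) 0 := by
      have h2 : HasFDerivAt (fderiv ℝ w) (fderiv ℝ (fderiv ℝ w) x) (ℓ 0) := by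
        rw [hℓ0]; exact hd2.hasFDerivAt
      exact h2.comp_hasDerivAt 0 (hℓ 0)
    simpa using h1.clm_apply (hasDerivAt_const (0 : ℝ) v)
  have hdd' : deriv (deriv fun t => w (ℓ t)) 0 = fderiv ℝ (fderiv ℝ w) x v v := by
    rw [hderiv.deriv_eq, hdd.deriv]
  have hmin' : IsLocalMin (fun t => w (ℓ t)) 0 := by
    have := hℓc.eventually hmin
    simpa [IsLocalMin, IsMinFilter, hℓ0] using this
  by_contra hneg
  push Not at hneg
  have hmax : IsLocalMax (fun t => w (ℓ t)) 0 :=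
    isLocalMax_of_deriv_deriv_neg (by rw [hdd']; exact hneg) hmin'.deriv_eq_zero
      (hd1.self_of_nhds).continuousAt
  have hconst : (fun t => w (ℓ t)) =ᶠ[𝓝 0] fun _ => w (ℓ 0) := by
    filter_upwards [hmin', hmax] with t h1 h2 using le_antisymm h2 h1
  have : deriv (fun t => w (ℓ t)) =ᶠ[𝓝 0] deriv fun _ => w (ℓ 0) := hconst.deriv
  have h0 := this.deriv_eq
  rw [hdd'] at h0
  simp at h0
  linarith

/-- The coordinate vectors of the plane. -/
abbrev stdVec (i : Fin 2) : Plane := EuclideanSpace.single i (1 : ℝ)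

theorem eq_sum_stdVec (v : Plane) : v = v 0 • stdVec 0 + v 1 • stdVec 1 := by
  ext i; fin_cases i <;> simp [stdVec]

/-- The second order linear operator with principal coefficients `a` and drift `b`. -/
def ellOp (a : Fin 2 → Fin 2 → Plane → ℝ) (b : Fin 2 → Plane → ℝ) (w : Plane → ℝ) (y : Plane) : ℝ :=
  ∑ i, ∑ j, a i j y * fderiv ℝ (fderiv ℝ w) y (stdVec i) (stdVec j) +
    ∑ j, b j y * fderiv ℝ w y (stdVec j)

/-- Symmetric positive definite families of coefficients. -/
structure IsElliptic (a : Fin 2 → Fin 2 → Plane → ℝ) (V : Set Plane) : Prop where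
  symm : ∀ y ∈ V, a 0 1 y = a 1 0 y
  pos : ∀ y ∈ V, ∀ ξ : Fin 2 → ℝ, ξ ≠ 0 → 0 < ∑ i, ∑ j, a i j y * (ξ i * ξ j)

/-- Completing the square: with v = a₀₀e₀ + a₀₁e₁, one has a₀₀ tr(aH) = H(v,v) + det(a) H(e₁,e₁). -/
theorem IsElliptic.trace_nonneg {a : Fin 2 → Fin 2 → Plane → ℝ} {V : Set Plane}
    (ha : IsElliptic a V) {y : Plane} (hy : y ∈ V) (H : Plane →L[ℝ] Plane →L[ℝ] ℝ)
    (hs : H (stdVec 0) (stdVec 1) = H (stdVec 1) (stdVec 0)) (hH : ∀ v, 0 ≤ H v v) :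
    0 ≤ ∑ i, ∑ j, a i j y * H (stdVec i) (stdVec j) := by
  -- The two test vectors yield a₀₀ > 0 and a₀₀ det(a) > 0.
  have h0 := ha.pos y hy ![1, 0] (by intro h; simpa using congrFun h 0)
  have h1 := ha.pos y hy ![-a 0 1 y, a 0 0 y] (by
    intro h
    have := congrFun h 1
    simp at this
    simp [Fin.sum_univ_two, this] at h0)
  simp [Fin.sum_univ_two] at h0 h1 ⊢
  have hsy := ha.symm y hy
  have hv := hH (a 0 0 y • stdVec 0 + a 0 1 y • stdVec 1)
  have he := hH (stdVec 1)
  simp only [map_add, map_smul, add_apply, smul_apply,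
    smul_eq_mul] at hv
  rw [← hs] at hv ⊢
  rw [← hsy] at h1 ⊢
  have hdet : 0 < a 0 0 y * a 1 1 y - a 0 1 y * a 0 1 y := by
    refine (mul_pos_iff_of_pos_left h0).1 ?_
    linarith
  have key : 0 ≤ a 0 0 y * (a 0 0 y * H (stdVec 0) (stdVec 0) + a 0 1 y * H (stdVec 0) (stdVec 1) +
      (a 0 1 y * H (stdVec 0) (stdVec 1) + a 1 1 y * H (stdVec 1) (stdVec 1))) := by
    nlinarith [mul_nonneg hdet.le he]
  exact nonneg_of_mul_nonneg_right key h0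

theorem ellOp_nonneg_of_isLocalMin {a : Fin 2 → Fin 2 → Plane → ℝ} {b : Fin 2 → Plane → ℝ}
    {V : Set Plane} (ha : IsElliptic a V) {w : Plane → ℝ} {y : Plane} (hy : y ∈ V)
    (hw : ContDiffAt ℝ 2 w y) (hmin : IsLocalMin w y) : 0 ≤ ellOp a b w y := by
  have h1 : fderiv ℝ w y = 0 := hmin.fderiv_eq_zero
  have h2 : IsSymmSndFDerivAt ℝ w y := hw.isSymmSndFDerivAt (by simp)
  simpa [ellOp, h1] using ha.trace_nonneg hy (fderiv ℝ (fderiv ℝ w) y) (h2 _ _)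
    (hessian_nonneg_of_isLocalMin hw hmin)

/-- The radial barrier `exp (-α |y - c|²)`. -/
def barrier (α : ℝ) (c y : Plane) : ℝ := Real.exp (-α * ‖y - c‖ ^ 2)

theorem hasFDerivAt_barrier (α : ℝ) (c y : Plane) :
    HasFDerivAt (barrier α c) ((-2 * α * barrier α c y) • innerSL ℝ (y - c)) y := by
  have h : HasFDerivAt (fun y : Plane => ‖y - c‖ ^ 2) (2 • innerSL ℝ (y - c)) y := by
    simpa using ((hasFDerivAt_id y).sub_const c).norm_sq
  have h2 : HasFDerivAt (barrier α c)
      (Real.exp (-α * ‖y - c‖ ^ 2) • -α • 2 • innerSL ℝ (y - c)) y := (h.const_mul (-α)).exp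
  refine h2.congr_fderiv ?_
  rw [← Nat.cast_smul_eq_nsmul ℝ, smul_smul, smul_smul, barrier]
  congr 1
  push_cast
  ring

theorem fderiv_barrier (α : ℝ) (c : Plane) :
    fderiv ℝ (barrier α c) = fun y => (-2 * α * barrier α c y) • innerSL ℝ (y - c) :=
  funext fun y => (hasFDerivAt_barrier α c y).fderiv

theorem contDiff_barrier (α : ℝ) (c : Plane) : ContDiff ℝ ∞ (barrier α c) := by
  unfold barrier
  exact Real.contDiff_exp.comp (contDiff_const.mul ((contDiff_id.sub contDiff_const).norm_sq ℝ))

theorem fderiv_fderiv_barrier (α : ℝ) (c y v u : Plane) :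
    fderiv ℝ (fderiv ℝ (barrier α c)) y v u =
      barrier α c y * (4 * α ^ 2 * (inner ℝ (y - c) v * inner ℝ (y - c) u) -
        2 * α * inner ℝ v u) := by
  have h1 : HasFDerivAt (fun y : Plane => innerSL ℝ (y - c)) (innerSL ℝ : Plane →L[ℝ] _) y :=
    (innerSL ℝ : Plane →L[ℝ] _).hasFDerivAt.comp y ((hasFDerivAt_id y).sub_const c)
  have h2 : HasFDerivAt (fun y => (-2 * α * barrier α c y) • innerSL ℝ (y - c)) _ y :=
    ((hasFDerivAt_barrier α c y).const_mul (-2 * α)).smul h1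
  rw [fderiv_barrier, HasFDerivAt.fderiv h2]
  simp only [add_apply, smul_apply, ContinuousLinearMap.smulRight_apply, innerSL_apply_apply,
    smul_eq_mul]
  rw [show (innerSL ℝ v) u = inner ℝ v u from rfl]
  ring

/-- The form isolates the positive definite quadratic term with an extra factor `α`: away from `c`
it dominates the trace and drift terms once `α` is large. -/
theorem ellOp_barrier (a : Fin 2 → Fin 2 → Plane → ℝ) (b : Fin 2 → Plane → ℝ) (α : ℝ)
    (c y : Plane) :
    ellOp a b (barrier α c) y = barrier α c y * (2 * α) *
      (2 * α * (∑ i, ∑ j, a i j y * ((y - c) i * (y - c) j)) -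
        (a 0 0 y + a 1 1 y + ∑ j, b j y * (y - c) j)) := by
  have h (j : Fin 2) : inner ℝ (y - c) (stdVec j) = (y - c) j := by
    simp [stdVec, EuclideanSpace.inner_single_right]
  simp only [ellOp, fderiv_fderiv_barrier, (hasFDerivAt_barrier α c y).fderiv, Fin.sum_univ_two,
    smul_apply, innerSL_apply_apply, h, smul_eq_mul]
  simp only [stdVec, EuclideanSpace.inner_single_left]
  simp
  ring

theorem barrier_pos (α : ℝ) (c y : Plane) : 0 < barrier α c y := Real.exp_pos _

theorem ellOp_sub_const_mul (a : Fin 2 → Fin 2 → Plane → ℝ) (b : Fin 2 → Plane → ℝ)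
    {w h : Plane → ℝ} {y : Plane} (hw : ContDiffAt ℝ 2 w y) (hh : ContDiffAt ℝ 2 h y) (ε k : ℝ) :
    ellOp a b (fun y => w y - ε * (h y - k)) y = ellOp a b w y - ε * ellOp a b h y := by
  have hev : fderiv ℝ (fun y => w y - ε * (h y - k)) =ᶠ[𝓝 y]
      fun y => fderiv ℝ w y - ε • fderiv ℝ h y := by
    filter_upwards [hw.eventually (by simp), hh.eventually (by simp)] with z h1 h2
    exact ((h1.differentiableAt (by simp)).hasFDerivAt.sub
      (((h2.differentiableAt (by simp)).hasFDerivAt.sub_const k).const_mul ε)).fderiv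
  have d1 := ((hw.fderiv_right (m := 1) (by norm_num)).differentiableAt (by simp)).hasFDerivAt
  have d2 := ((hh.fderiv_right (m := 1) (by norm_num)).differentiableAt (by simp)).hasFDerivAt
  have hsnd : fderiv ℝ (fderiv ℝ (fun y => w y - ε * (h y - k))) y =
      fderiv ℝ (fderiv ℝ w) y - ε • fderiv ℝ (fderiv ℝ h) y := by
    rw [hev.fderiv_eq]
    exact (d1.sub (d2.const_smul ε)).fderiv
  simp only [ellOp, hsnd, hev.self_of_nhds, Fin.sum_univ_two, sub_apply, smul_apply, smul_eq_mul]
  ring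

/-- Hopf's boundary point argument: a supersolution that is positive in a ball cannot vanish at a
boundary point of the ball if it is nonnegative around it. -/
theorem pos_on_sphere_of_pos_on_ball {a : Fin 2 → Fin 2 → Plane → ℝ} {b : Fin 2 → Plane → ℝ}
    {V : Set Plane} (hV : IsOpen V) (ha : IsElliptic a V) (hac : ∀ i j, ContinuousOn (a i j) V)
    (hbc : ∀ j, ContinuousOn (b j) V) {w : Plane → ℝ} (hw : ContDiffOn ℝ 2 w V)
    (hnn : ∀ y ∈ V, 0 ≤ w y) (hL : ∀ y ∈ V, ellOp a b w y ≤ 0) {c : Plane} {R : ℝ} (hR : 0 < R)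
    (hball : Metric.closedBall c R ⊆ V) (hpos : ∀ y ∈ Metric.ball c R, 0 < w y)
    {z : Plane} (hz : z ∈ Metric.sphere c R) : 0 < w z := by
  have hzV : z ∈ V := hball (Metric.sphere_subset_closedBall hz)
  refine lt_of_le_of_ne (hnn z hzV) fun hz0 => ?_
  have hzc : ‖z - c‖ = R := by simpa [dist_eq_norm] using hz
  -- On this annulus `y - c` stays away from 0, so the quadratic form of `a` has a positive minimum
  -- `m`.
  set K : Set Plane := Metric.closedBall c R \ Metric.ball c (R / 2) with hK
  have hKc : IsCompact K := (isCompact_closedBall c R).diff Metric.isOpen_ball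
  have hKV : K ⊆ V := sdiff_subset.trans hball
  have hzK : z ∈ K := by
    simp only [hK, Set.mem_sdiff, Metric.mem_closedBall, Metric.mem_ball, dist_eq_norm, hzc]
    constructor <;> linarith
  have hcont (j : Fin 2) : ContinuousOn (fun y : Plane => (y - c) j) K :=
    Continuous.continuousOn (by fun_prop)
  obtain ⟨y₁, hy₁, hmin₁⟩ := hKc.exists_isMinOn ⟨z, hzK⟩
    (f := fun y => ∑ i, ∑ j, a i j y * ((y - c) i * (y - c) j))
    (continuousOn_finsetSum _ fun i _ => continuousOn_finsetSum _ fun j _ =>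
      ((hac i j).mono hKV).mul ((hcont i).mul (hcont j)))
  obtain ⟨y₂, hy₂, hmax₂⟩ := hKc.exists_isMaxOn ⟨z, hzK⟩
    (f := fun y => a 0 0 y + a 1 1 y + ∑ j, b j y * (y - c) j)
    ((((hac 0 0).mono hKV).add ((hac 1 1).mono hKV)).add (continuousOn_finsetSum _ fun j _ =>
      ((hbc j).mono hKV).mul (hcont j)))
  set m := ∑ i, ∑ j, a i j y₁ * ((y₁ - c) i * (y₁ - c) j)
  set C := a 0 0 y₂ + a 1 1 y₂ + ∑ j, b j y₂ * (y₂ - c) j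
  have hm : 0 < m := by
    refine ha.pos y₁ (hKV hy₁) (fun i => (y₁ - c) i) fun h => ?_
    have : y₁ - c = 0 := by ext i; exact congrFun h i
    have h2 := hy₁.2
    simp only [Metric.mem_ball, dist_eq_norm, this, norm_zero] at h2
    linarith
  -- Chosen so that 2αm - C ≥ 2(|C| + 1) - C > 0, which makes the barrier a strict subsolution on
  -- `K`.
  set α := (|C| + 1) / m
  have hα : 0 < α := by positivity
  have hαm : α * m = |C| + 1 := by simp only [α]; field_simp
  have hLh : ∀ y ∈ K, 0 < ellOp a b (barrier α c) y := by
    intro y hy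
    rw [ellOp_barrier]
    have h1 := hmin₁ hy
    have h2 := hmax₂ hy
    simp only [mem_ofPred_eq] at h1 h2
    have h3 := mul_le_mul_of_nonneg_left h1 hα.le
    have := le_abs_self C
    have := abs_nonneg C
    refine mul_pos (mul_pos (barrier_pos _ _ _) (by positivity)) ?_
    linarith
  have hSne : (Metric.sphere c (R / 2)).Nonempty := by
    refine ⟨c + (1 / 2 : ℝ) • (z - c), ?_⟩
    simp [norm_smul, hzc]; ring
  have hSb : Metric.sphere c (R / 2) ⊆ Metric.ball c R := fun y hy => by
    simp only [Metric.mem_sphere, Metric.mem_ball] at hy ⊢; linarith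
  obtain ⟨y₃, hy₃, hmin₃⟩ := (isCompact_sphere c (R / 2)).exists_isMinOn hSne
    (hw.continuousOn.mono (hSb.trans (Metric.ball_subset_closedBall.trans hball)))
  set ε := w y₃
  have hε : 0 < ε := hpos _ (hSb hy₃)
  set k := Real.exp (-α * R ^ 2)
  -- The barrier equals `k` on the outer sphere, so there f = w ≥ 0. On the inner sphere w ≥ ε and
  -- the barrier is at most 1. A negative minimum would therefore be interior, where the operator
  -- applied to `f` is both nonnegative and negative.
  set f : Plane → ℝ := fun y => w y - ε * (barrier α c y - k) with hf
  have hbar : ContDiff ℝ ∞ (barrier α c) := contDiff_barrier α c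
  have hfc : ContDiffOn ℝ 2 f V :=
    hw.sub (contDiffOn_const.mul ((hbar.of_le (by norm_cast)).contDiffOn.sub
      contDiffOn_const))
  have hf0 : ∀ y ∈ K, 0 ≤ f y := by
    obtain ⟨y, hy, hmin⟩ := hKc.exists_isMinOn ⟨z, hzK⟩ (hfc.continuousOn.mono hKV)
    suffices 0 ≤ f y from fun x hx => this.trans (hmin hx)
    by_contra hneg
    push Not at hneg
    have hyV := hKV hy
    have hne1 : dist y c ≠ R := by
      intro h
      have : barrier α c y = k := by simp only [barrier, k, ← dist_eq_norm, h]
      simp only [hf, this] at hneg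
      have := hnn y hyV
      linarith
    have hne2 : dist y c ≠ R / 2 := by
      intro h
      have h1 : ε ≤ w y := hmin₃ h
      have h2 : barrier α c y ≤ 1 := Real.exp_le_one_iff.2 (by
        have := mul_nonneg hα.le (sq_nonneg ‖y - c‖)
        linarith)
      have h3 : 0 < k := Real.exp_pos _
      have : ε * (barrier α c y - k) ≤ ε * 1 := mul_le_mul_of_nonneg_left (by linarith) hε.le
      simp only [hf] at hneg
      linarith
    have hKn : K ∈ 𝓝 y := by
      have h1 : y ∈ Metric.ball c R := lt_of_le_of_ne hy.1 hne1
      have h2 : y ∈ (Metric.closedBall c (R / 2))ᶜ := by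
        have := hy.2
        simp only [Metric.mem_ball, mem_compl_iff, Metric.mem_closedBall, not_lt, not_le] at this ⊢
        exact lt_of_le_of_ne this hne2.symm
      filter_upwards [Metric.isOpen_ball.mem_nhds h1,
        Metric.isClosed_closedBall.isOpen_compl.mem_nhds h2] with x h3 h4
      exact ⟨Metric.ball_subset_closedBall h3, fun h5 => h4 (Metric.ball_subset_closedBall h5)⟩
    have hloc : IsLocalMin f y := hmin.isLocalMin hKn
    have h1 := ellOp_nonneg_of_isLocalMin (b := b) ha hyV (hfc.contDiffAt (hV.mem_nhds hyV)) hloc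
    rw [ellOp_sub_const_mul a b (hw.contDiffAt (hV.mem_nhds hyV))
      (hbar.of_le (by norm_cast)).contDiffAt] at h1
    have h2 := hL y hyV
    have h3 := mul_pos hε (hLh y hy)
    linarith
  have hbz : barrier α c z = k := by simp only [barrier, k, hzc]
  have hfz : f z = 0 := by simp only [hf, ← hz0, hbz]; ring
  have hminz : IsLocalMinOn f K z := by
    filter_upwards [self_mem_nhdsWithin] with y hy
    rw [hfz]; exact hf0 y hy
  -- Since `w` is nonnegative on all of `V`, its differential vanishes at `z`, and the slope of `f`
  -- there comes from the barrier alone.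
  have hwmin : IsLocalMin w z := by
    filter_upwards [hV.mem_nhds hzV] with y hy
    rw [← hz0]; exact hnn y hy
  have hwd : HasFDerivAt w (0 : Plane →L[ℝ] ℝ) z := by
    have := ((hw.contDiffAt (hV.mem_nhds hzV)).differentiableAt (by simp)).hasFDerivAt
    rwa [hwmin.fderiv_eq_zero] at this
  have hfd : HasFDerivAt f _ z :=
    hwd.sub (((hasFDerivAt_barrier α c z).sub_const k).const_mul ε)
  have hseg : segment ℝ z (z + (1 / 2 : ℝ) • (c - z)) ⊆ K := by
    rw [segment_eq_image']
    rintro _ ⟨θ, hθ, rfl⟩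
    have : z + θ • (z + (1 / 2 : ℝ) • (c - z) - z) - c = (1 - θ / 2) • (z - c) := by module
    have hn : dist (z + θ • (z + (1 / 2 : ℝ) • (c - z) - z)) c = (1 - θ / 2) * R := by
      rw [dist_eq_norm, this, norm_smul, hzc, Real.norm_of_nonneg (by linarith [hθ.2])]
    simp only [hK, Set.mem_sdiff, Metric.mem_closedBall, Metric.mem_ball, hn, not_lt]
    constructor <;> nlinarith [hθ.1, hθ.2]
  -- In the inward direction (c - z)/2 the derivative of `f` at `z` is -εαkR² < 0, although `z`
  -- minimizes `f` on `K`.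
  have := hminz.hasFDerivWithinAt_nonneg hfd.hasFDerivWithinAt
    (mem_posTangentConeAt_of_segment_subset hseg)
  have hin : inner ℝ (z - c) (c - z) = -R ^ 2 := by
    rw [← neg_sub z c, inner_neg_right, real_inner_self_eq_norm_sq, hzc]
  simp only [sub_apply, zero_apply, smul_apply, innerSL_apply_apply, inner_smul_right, hin,
    smul_eq_mul, hbz] at this
  have hk : 0 < k := Real.exp_pos _
  have : 0 < ε * α * k * R ^ 2 := by positivity
  linarith

/-- **Strong minimum principle**: the zero set of a nonnegative supersolution is open. -/
theorem eventually_eq_zero_of_ellOp_nonpos {a : Fin 2 → Fin 2 → Plane → ℝ}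
    {b : Fin 2 → Plane → ℝ} {V : Set Plane} (hV : IsOpen V) (ha : IsElliptic a V)
    (hac : ∀ i j, ContinuousOn (a i j) V) (hbc : ∀ j, ContinuousOn (b j) V) {w : Plane → ℝ}
    (hw : ContDiffOn ℝ 2 w V) (hnn : ∀ y ∈ V, 0 ≤ w y) (hL : ∀ y ∈ V, ellOp a b w y ≤ 0)
    {x : Plane} (hx : x ∈ V) (h0 : w x = 0) : ∀ᶠ y in 𝓝 x, w y = 0 := by
  obtain ⟨ρ, hρ, hρV⟩ := Metric.nhds_basis_closedBall.mem_iff.1 (hV.mem_nhds hx)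
  by_contra hne
  obtain ⟨c, hcw, hc⟩ := ((not_eventually.1 hne).and_eventually
    (Metric.ball_mem_nhds x (half_pos hρ))).exists
  set Z : Set Plane := Metric.closedBall x ρ ∩ w ⁻¹' {0}
  have hZc : IsCompact Z := (isCompact_closedBall x ρ).of_isClosed_subset
    ((hw.continuousOn.mono hρV).preimage_isClosed_of_isClosed Metric.isClosed_closedBall
      isClosed_singleton) inter_subset_left
  have hxZ : x ∈ Z := ⟨Metric.mem_closedBall_self hρ.le, h0⟩
  -- Take the zero nearest to a point `c` where `w` does not vanish. As `c` lies within ρ/2 of `x`,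
  -- the ball about `c` with `z` on its boundary stays inside the ρ-ball, and `w` is positive in its
  -- interior: Hopf's argument applies at `z`.
  obtain ⟨z, hz, hmin⟩ := hZc.exists_isMinOn ⟨x, hxZ⟩ (f := fun y => dist y c) (by fun_prop)
  have hR : 0 < dist z c := dist_pos.2 fun h => hcw (h ▸ hz.2)
  have hRx : dist z c ≤ dist c x := by rw [dist_comm c x]; exact hmin hxZ
  have hsub : Metric.closedBall c (dist z c) ⊆ Metric.closedBall x ρ := fun y hy => by
    rw [Metric.mem_closedBall] at hy ⊢
    linarith [dist_triangle y c x]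
  have := pos_on_sphere_of_pos_on_ball hV ha hac hbc hw hnn hL hR (hsub.trans hρV)
    (fun y hy => ?_) (z := z) rfl
  · exact this.ne' hz.2
  · have hyb := hsub (Metric.ball_subset_closedBall hy)
    refine lt_of_le_of_ne (hnn y (hρV hyb)) fun h => ?_
    exact (not_le.2 (Metric.mem_ball.1 hy)) (hmin (show y ∈ Z from ⟨hyb, h.symm⟩))

end StrongMinimum

/-! ### Integration by parts in the plane and the Piola transform. -/

section PlaneCalculus

open MeasureTheory

/-- The Euclidean divergence of a vector field on the plane. -/
def planeDiv (Z : Plane → Plane) (y : Plane) : ℝ :=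
  ∑ i : Fin 2, fderiv ℝ (fun y => Z y i) y (stdVec i)

theorem integral_sum_fderiv_eq_zero {Y : Fin 2 → Plane → ℝ} (hY : ∀ i, ContDiff ℝ 1 (Y i))
    (hc : ∀ i, HasCompactSupport (Y i)) : ∫ y, ∑ i, fderiv ℝ (Y i) y (stdVec i) = 0 := by
  have hint (i) : Integrable (fun y => fderiv ℝ (Y i) y (stdVec i)) := by
    refine Continuous.integrable_of_hasCompactSupport ?_ ((hc i).fderiv_apply ℝ _)
    exact ((hY i).continuous_fderiv (by simp)).clm_apply continuous_const
  rw [integral_finsetSum _ fun i _ => hint i]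
  refine Finset.sum_eq_zero fun i _ => ?_
  have := integral_mul_fderiv_eq_neg_fderiv_mul_of_integrable (μ := (volume : Measure Plane))
    (f := fun _ : Plane => (1 : ℝ)) (g := Y i) (v := stdVec i) (by simp) (by simpa using hint i)
    (by simpa using (hY i).continuous.integrable_of_hasCompactSupport (hc i))
    (fun x _ => differentiableAt_const _) (fun x _ => (hY i).differentiable (by simp) x)
  simpa using this

/-- Fields are controlled only on `V`; a factor whose topological support lies in `V` makes the
product globally regular, whatever the values of `g` elsewhere. -/
theorem contDiff_mul_of_tsupport_subset {φ g : Plane → ℝ} {V : Set Plane} (hV : IsOpen V)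
    (hφ : ContDiff ℝ 1 φ) (hφV : tsupport φ ⊆ V) (hg : ContDiffOn ℝ 1 g V) :
    ContDiff ℝ 1 fun y => φ y * g y := by
  refine contDiff_iff_contDiffAt.2 fun y => ?_
  by_cases hy : y ∈ tsupport φ
  · exact hφ.contDiffAt.mul (hg.contDiffAt (hV.mem_nhds (hφV hy)))
  · have : (fun y => φ y * g y) =ᶠ[𝓝 y] fun _ => 0 := by
      filter_upwards [(isClosed_tsupport φ).isOpen_compl.mem_nhds hy] with x hx
      simp [image_eq_zero_of_notMem_tsupport hx]
    exact contDiffAt_const.congr_of_eventuallyEq this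

theorem continuous_fderiv_apply {φ : Plane → ℝ} {Z : Plane → Plane} {V : Set Plane}
    (hV : IsOpen V) (hφ : ContDiff ℝ 1 φ) (hφV : tsupport φ ⊆ V) (hZ : ContinuousOn Z V) :
    Continuous fun y => fderiv ℝ φ y (Z y) := by
  refine continuous_iff_continuousAt.2 fun y => ?_
  by_cases hy : y ∈ tsupport φ
  · exact (hφ.continuous_fderiv (by simp)).continuousAt.clm_apply
      (hZ.continuousAt (hV.mem_nhds (hφV hy)))
  · have : (fun y => fderiv ℝ φ y (Z y)) =ᶠ[𝓝 y] fun _ => 0 := by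
      filter_upwards [(isClosed_tsupport φ).isOpen_compl.mem_nhds hy] with x hx
      have : fderiv ℝ φ x = 0 := image_eq_zero_of_notMem_tsupport
        (fun h => hx (tsupport_fderiv_subset ℝ h))
      simp [this]
    exact continuousAt_const.congr this.symm

/-- Integration by parts against a compactly supported function. -/
theorem integral_fderiv_apply_eq_neg {φ : Plane → ℝ} {Z : Plane → Plane} {V : Set Plane}
    (hV : IsOpen V) (hφ : ContDiff ℝ 1 φ) (hc : HasCompactSupport φ) (hφV : tsupport φ ⊆ V)
    (hZ : ContDiffOn ℝ 1 Z V) :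
    ∫ y, fderiv ℝ φ y (Z y) = -∫ y, φ y * planeDiv Z y := by
  have hZi (i : Fin 2) : ContDiffOn ℝ 1 (fun y => Z y i) V := fun y hy =>
    (contDiffWithinAt_piLp 2).1 (hZ y hy) i
  have hcont := continuous_fderiv_apply hV hφ hφV hZ.continuousOn
  have hcs : HasCompactSupport fun y => fderiv ℝ φ y (Z y) := by
    refine (hc.fderiv ℝ).mono fun y hy => ?_
    simp only [Function.mem_support] at hy ⊢
    intro h; simp [h] at hy
  have hzero := integral_sum_fderiv_eq_zero
    (fun i => contDiff_mul_of_tsupport_subset hV hφ hφV (hZi i))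
    (fun i => hc.mul_right (f' := fun y => Z y i))
  have hpt : ∀ y, ∑ i, fderiv ℝ (fun y => φ y * Z y i) y (stdVec i) =
      fderiv ℝ φ y (Z y) + φ y * planeDiv Z y := by
    intro y
    by_cases hy : y ∈ tsupport φ
    · have h (i : Fin 2) := ((hφ.differentiable (by simp) y).hasFDerivAt.mul
        (((hZi i).contDiffAt (hV.mem_nhds (hφV hy))).differentiableAt
          (by simp)).hasFDerivAt).fderiv
      have h' (i : Fin 2) : fderiv ℝ (fun y => φ y * Z y i) y = _ := h i
      conv_rhs => rw [eq_sum_stdVec (Z y)]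
      simp only [h', planeDiv, Fin.sum_univ_two, add_apply, smul_apply, smul_eq_mul, map_add,
        map_smul]
      ring
    · have h0 : φ =ᶠ[𝓝 y] fun _ => 0 := notMem_tsupport_iff_eventuallyEq.1 hy
      have h1 (i : Fin 2) : (fun y => φ y * Z y i) =ᶠ[𝓝 y] fun _ => 0 := by
        filter_upwards [h0] with x hx using by simp [hx]
      simp [h0.fderiv_eq, (h1 _).fderiv_eq, h0.self_of_nhds]
  simp_rw [hpt] at hzero
  have hi1 := hcont.integrable_of_hasCompactSupport (μ := volume) hcs
  -- Integrability is obtained by difference from the product rule `hpt`.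
  have hi2 : Integrable fun y => φ y * planeDiv Z y := by
    have hsum : Integrable fun y => ∑ i, fderiv ℝ (fun y => φ y * Z y i) y (stdVec i) := by
      refine integrable_finsetSum _ fun i _ => ?_
      refine Continuous.integrable_of_hasCompactSupport ?_
        ((hc.mul_right (f' := fun y => Z y i)).fderiv_apply ℝ _)
      exact ((contDiff_mul_of_tsupport_subset hV hφ hφV (hZi i)).continuous_fderiv
        (by simp)).clm_apply continuous_const
    refine (hsum.sub hi1).congr (.of_forall fun y => ?_)
    simp [hpt]
  rw [integral_add hi1 hi2] at hzero
  linarith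

theorem det_eq_stdVec (A : Plane →L[ℝ] Plane) :
    A.det = A (stdVec 0) 0 * A (stdVec 1) 1 - A (stdVec 1) 0 * A (stdVec 0) 1 := by
  rw [ContinuousLinearMap.det, ← LinearMap.det_toMatrix (EuclideanSpace.basisFun (Fin 2) ℝ).toBasis,
    Matrix.det_fin_two]
  simp [LinearMap.toMatrix_apply, stdVec]

theorem apply_eq_stdVec (A : Plane →L[ℝ] Plane) (v : Plane) (k : Fin 2) :
    A v k = A (stdVec 0) k * v 0 + A (stdVec 1) k * v 1 := by
  conv_lhs => rw [eq_sum_stdVec v]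
  simp
  ring

theorem planeDiv_sub {Z Z' : Plane → Plane} {y : Plane} (hZ : DifferentiableAt ℝ Z y)
    (hZ' : DifferentiableAt ℝ Z' y) :
    planeDiv (fun y => Z y - Z' y) y = planeDiv Z y - planeDiv Z' y := by
  rw [planeDiv, planeDiv, planeDiv, ← Finset.sum_sub_distrib]
  refine Finset.sum_congr rfl fun i _ => ?_
  have h {Z : Plane → Plane} (hZ : DifferentiableAt ℝ Z y) :
      HasFDerivAt (fun y => Z y i) (fderiv ℝ (fun y => Z y i) y) y :=
    ((differentiableAt_piLp 2).1 hZ i).hasFDerivAt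
  exact congrArg (fun A : Plane →L[ℝ] ℝ => A (stdVec i)) ((h hZ).sub (h hZ')).fderiv

/-- The Piola transform of a vector field under a change of variables has the transformed
divergence. -/
theorem planeDiv_piola {ψ Z Z' : Plane → Plane} {y : Plane} (hψ : ContDiffAt ℝ 2 ψ y)
    (hZ : DifferentiableAt ℝ Z (ψ y)) (hdet : (fderiv ℝ ψ y).det ≠ 0)
    (h : ∀ᶠ x in 𝓝 y, fderiv ℝ ψ x (Z' x) = |(fderiv ℝ ψ x).det| • Z (ψ x)) :
    planeDiv Z' y = |(fderiv ℝ ψ y).det| * planeDiv Z (ψ y) := by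
  have hd : DifferentiableAt ℝ (fderiv ℝ ψ) y :=
    (hψ.fderiv_right (m := 1) (by norm_num)).differentiableAt (by simp)
  have hdetc : ContinuousAt (fun x => (fderiv ℝ ψ x).det) y :=
    ContinuousLinearMap.continuous_det.continuousAt.comp hd.continuousAt
  -- The sign of the Jacobian is locally constant, so the absolute value can be differentiated as
  -- `s` times the determinant.
  obtain ⟨s, hs, hsd⟩ : ∃ s : ℝ, s * s = 1 ∧
      ∀ᶠ x in 𝓝 y, (fderiv ℝ ψ x).det ≠ 0 ∧
        |(fderiv ℝ ψ x).det| = s * (fderiv ℝ ψ x).det := by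
    rcases hdet.lt_or_gt with hneg | hpos
    · refine ⟨-1, by norm_num, ?_⟩
      filter_upwards [hdetc.eventually_lt continuousAt_const hneg] with x hx
      exact ⟨hx.ne, by rw [abs_of_neg hx]; ring⟩
    · refine ⟨1, by norm_num, ?_⟩
      filter_upwards [continuousAt_const.eventually_lt hdetc hpos] with x hx
      exact ⟨hx.ne', by rw [abs_of_pos hx]; ring⟩
  set J : Fin 2 → Fin 2 → Plane → ℝ := fun k i x => fderiv ℝ ψ x (stdVec i) k with hJ
  -- Cramer's rule: `Z'` is `s` times the adjugate of Dψ applied to Z ∘ ψ. The determinant cancels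
  -- and never has to be differentiated.
  have hZ'0 : (fun x => Z' x 0) =ᶠ[𝓝 y]
      fun x => s * (J 1 1 x * Z (ψ x) 0 - J 0 1 x * Z (ψ x) 1) := by
    filter_upwards [h, hsd] with x hx ⟨hx1, hx2⟩
    have h0 := congrArg (fun v : Plane => v 0) hx
    have h1 := congrArg (fun v : Plane => v 1) hx
    simp only [apply_eq_stdVec _ (Z' x), hx2, PiLp.smul_apply, smul_eq_mul] at h0 h1
    refine mul_left_cancel₀ hx1 ?_
    rw [det_eq_stdVec] at *
    simp only [hJ]
    linear_combination (fderiv ℝ ψ x (stdVec 1) 1) * h0 - (fderiv ℝ ψ x (stdVec 1) 0) * h1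
  have hZ'1 : (fun x => Z' x 1) =ᶠ[𝓝 y]
      fun x => s * (J 0 0 x * Z (ψ x) 1 - J 1 0 x * Z (ψ x) 0) := by
    filter_upwards [h, hsd] with x hx ⟨hx1, hx2⟩
    have h0 := congrArg (fun v : Plane => v 0) hx
    have h1 := congrArg (fun v : Plane => v 1) hx
    simp only [apply_eq_stdVec _ (Z' x), hx2, PiLp.smul_apply, smul_eq_mul] at h0 h1
    refine mul_left_cancel₀ hx1 ?_
    rw [det_eq_stdVec] at *
    simp only [hJ]
    linear_combination (fderiv ℝ ψ x (stdVec 0) 0) * h1 - (fderiv ℝ ψ x (stdVec 0) 1) * h0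
  have hproj (k : Fin 2) : ∀ x, HasFDerivAt (fun v : Plane => v k)
      (EuclideanSpace.proj k : Plane →L[ℝ] ℝ) x := fun x =>
    (EuclideanSpace.proj k : Plane →L[ℝ] ℝ).hasFDerivAt
  have hJd (k i : Fin 2) : HasFDerivAt (J k i) ((EuclideanSpace.proj k : Plane →L[ℝ] ℝ) ∘L
      ((fderiv ℝ (fderiv ℝ ψ) y).flip (stdVec i))) y := by
    have h1 : HasFDerivAt (fun x => fderiv ℝ ψ x (stdVec i))
        ((fderiv ℝ (fderiv ℝ ψ) y).flip (stdVec i)) y := by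
      simpa using hd.hasFDerivAt.clm_apply (hasFDerivAt_const (stdVec i) y)
    exact (hproj k _).comp y h1
  have hψd : HasFDerivAt ψ (fderiv ℝ ψ y) y := (hψ.differentiableAt (by simp)).hasFDerivAt
  have hZd (k : Fin 2) : HasFDerivAt (fun x => Z (ψ x) k)
      ((fderiv ℝ (fun z => Z z k) (ψ y)) ∘L fderiv ℝ ψ y) y := by
    have : HasFDerivAt (fun z => Z z k) (fderiv ℝ (fun z => Z z k) (ψ y)) (ψ y) :=
      ((hproj k _).comp (ψ y) hZ.hasFDerivAt).differentiableAt.hasFDerivAt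
    exact this.comp y hψd
  -- Symmetry of second derivatives makes the rows of the cofactor matrix divergence free, so only
  -- derivatives of `Z` survive.
  have hsym : fderiv ℝ (fderiv ℝ ψ) y (stdVec 0) (stdVec 1) =
      fderiv ℝ (fderiv ℝ ψ) y (stdVec 1) (stdVec 0) := (hψ.isSymmSndFDerivAt (by simp)) _ _
  have e0 : fderiv ℝ (fun x => Z' x 0) y = _ := hZ'0.fderiv_eq.trans
    ((((hJd 1 1).mul (hZd 0)).sub ((hJd 0 1).mul (hZd 1))).const_mul s).fderiv
  have e1 : fderiv ℝ (fun x => Z' x 1) y = _ := hZ'1.fderiv_eq.trans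
    ((((hJd 0 0).mul (hZd 1)).sub ((hJd 1 0).mul (hZd 0))).const_mul s).fderiv
  have hlin (k i : Fin 2) : fderiv ℝ (fun z => Z z k) (ψ y) (fderiv ℝ ψ y (stdVec i)) =
      fderiv ℝ ψ y (stdVec i) 0 * fderiv ℝ (fun z => Z z k) (ψ y) (stdVec 0) +
      fderiv ℝ ψ y (stdVec i) 1 * fderiv ℝ (fun z => Z z k) (ψ y) (stdVec 1) := by
    conv_lhs => rw [eq_sum_stdVec (fderiv ℝ ψ y (stdVec i))]
    simp
  rw [hsd.self_of_nhds.2, det_eq_stdVec]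
  simp only [planeDiv, Fin.sum_univ_two, e0, e1]
  simp only [hJ, add_apply, sub_apply, smul_apply, ContinuousLinearMap.comp_apply,
    ContinuousLinearMap.flip_apply, hlin, hsym, smul_eq_mul]
  ring

end PlaneCalculus

/-! ### Tangent maps, metric coefficients and area density in charts. -/

section ChartCalculus

variable {M : Type*} [TopologicalSpace M] [ChartedSpace Plane M]

/-- The derivative of the preferred chart at `p`, as a map of the plane. -/
def chartDeriv (p x : M) : Plane →L[ℝ] Plane :=
  mfderiv (𝓡 2) 𝓘(ℝ, Plane) (extChartAt (𝓡 2) p) x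

/-- The derivative of the inverse of the preferred chart at `p`, as a map of the plane. -/
def chartInvDeriv (p : M) (y : Plane) : Plane →L[ℝ] Plane :=
  mfderiv 𝓘(ℝ, Plane) (𝓡 2) (extChartAt (𝓡 2) p).symm y

/-- The transition map between two preferred charts. -/
def transition (p q : M) : Plane → Plane :=
  extChartAt (𝓡 2) q ∘ (extChartAt (𝓡 2) p).symm

theorem isOpen_chartTarget (p : M) : IsOpen (extChartAt (𝓡 2) p).target :=
  isOpen_extChartAt_target p

theorem symm_transition {p q : M} {y : Plane}
    (hyq : (extChartAt (𝓡 2) p).symm y ∈ (extChartAt (𝓡 2) q).source) :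
    (extChartAt (𝓡 2) q).symm (transition p q y) = (extChartAt (𝓡 2) p).symm y :=
  (extChartAt (𝓡 2) q).left_inv hyq

theorem transition_mem_target {p q : M} {y : Plane}
    (hyq : (extChartAt (𝓡 2) p).symm y ∈ (extChartAt (𝓡 2) q).source) :
    transition p q y ∈ (extChartAt (𝓡 2) q).target :=
  (extChartAt (𝓡 2) q).map_source hyq

theorem isOpen_chart_inter (p : M) {U : Set M} (hU : IsOpen U) :
    IsOpen ((extChartAt (𝓡 2) p).target ∩ (extChartAt (𝓡 2) p).symm ⁻¹' U) :=
  (continuousOn_extChartAt_symm p).isOpen_inter_preimage (isOpen_chartTarget p) hU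

/-- A vector field on `M`, read as a map to the model plane. -/
def vecAt (X : ∀ x : M, TangentSpace (𝓡 2) x) (x : M) : Plane := X x

theorem coordComp_eq (X : ∀ x : M, TangentSpace (𝓡 2) x) (p : M) (y : Plane) :
    coordComp X p y = chartDeriv p ((extChartAt (𝓡 2) p).symm y)
      (vecAt X ((extChartAt (𝓡 2) p).symm y)) := rfl

/-- The differential of a function, as a linear form on the model plane. -/
def diffAt (u : M → ℝ) (x : M) : Plane →L[ℝ] ℝ := mfderiv (𝓡 2) 𝓘(ℝ, ℝ) u x

/-- Domain of the coordinate expression of a function defined on `Ω`. -/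
def chartDomain (Ω : Set M) (p : M) : Set Plane :=
  (extChartAt (𝓡 2) p).target ∩ (extChartAt (𝓡 2) p).symm ⁻¹' Ω

theorem isOpen_chartDomain {Ω : Set M} (hΩ : IsOpen Ω) (p : M) : IsOpen (chartDomain Ω p) :=
  isOpen_chart_inter p hΩ

theorem mdifferentiableAt_of_mem {Ω : Set M} {u : M → ℝ} (hΩ : IsOpen Ω)
    (hu : ContMDiffOn (𝓡 2) 𝓘(ℝ, ℝ) 2 u Ω) {x : M}
    (hx : x ∈ Ω) : MDifferentiableAt (𝓡 2) 𝓘(ℝ, ℝ) u x :=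
  (hu.contMDiffAt (hΩ.mem_nhds hx)).mdifferentiableAt (by simp)

section

variable [IsManifold (𝓡 2) ∞ M]

theorem mdifferentiableAt_chart {p x : M} (hx : x ∈ (extChartAt (𝓡 2) p).source) :
    MDifferentiableAt (𝓡 2) 𝓘(ℝ, Plane) (extChartAt (𝓡 2) p) x :=
  mdifferentiableAt_extChartAt (by rwa [extChartAt_source] at hx)

theorem mdifferentiableAt_chart_symm {p : M} {y : Plane} (hy : y ∈ (extChartAt (𝓡 2) p).target) :
    MDifferentiableAt 𝓘(ℝ, Plane) (𝓡 2) (extChartAt (𝓡 2) p).symm y := by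
  have := mdifferentiableWithinAt_extChartAt_symm (I := 𝓡 2) hy
  rwa [ModelWithCorners.range_eq_univ, mdifferentiableWithinAt_univ] at this

theorem chartDeriv_comp_chartInvDeriv {p : M} {y : Plane} (hy : y ∈ (extChartAt (𝓡 2) p).target) :
    chartDeriv p ((extChartAt (𝓡 2) p).symm y) ∘L chartInvDeriv p y =
      ContinuousLinearMap.id ℝ Plane := by
  have := mfderiv_extChartAt_comp_mfderivWithin_extChartAt_symm (I := 𝓡 2) hy
  rw [ModelWithCorners.range_eq_univ, mfderivWithin_univ] at this
  exact this

theorem chartInvDeriv_comp_chartDeriv {p : M} {y : Plane} (hy : y ∈ (extChartAt (𝓡 2) p).target) :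
    chartInvDeriv p y ∘L chartDeriv p ((extChartAt (𝓡 2) p).symm y) =
      ContinuousLinearMap.id ℝ Plane := by
  have := mfderivWithin_extChartAt_symm_comp_mfderiv_extChartAt (I := 𝓡 2) hy
  rw [ModelWithCorners.range_eq_univ, mfderivWithin_univ] at this
  exact this

theorem chartInvDeriv_chartDeriv {p : M} {y : Plane} (hy : y ∈ (extChartAt (𝓡 2) p).target)
    (v : Plane) : chartInvDeriv p y (chartDeriv p ((extChartAt (𝓡 2) p).symm y) v) = v :=
  congrArg (fun A : Plane →L[ℝ] Plane => A v) (chartInvDeriv_comp_chartDeriv hy)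

theorem chartDeriv_chartInvDeriv {p : M} {y : Plane} (hy : y ∈ (extChartAt (𝓡 2) p).target)
    (v : Plane) : chartDeriv p ((extChartAt (𝓡 2) p).symm y) (chartInvDeriv p y v) = v :=
  congrArg (fun A : Plane →L[ℝ] Plane => A v) (chartDeriv_comp_chartInvDeriv hy)

theorem fderiv_transition {p q : M} {y : Plane} (hy : y ∈ (extChartAt (𝓡 2) p).target)
    (hyq : (extChartAt (𝓡 2) p).symm y ∈ (extChartAt (𝓡 2) q).source) :
    fderiv ℝ (transition p q) y =
      chartDeriv q ((extChartAt (𝓡 2) p).symm y) ∘L chartInvDeriv p y := by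
  rw [← mfderiv_eq_fderiv]
  exact mfderiv_comp y (mdifferentiableAt_chart hyq) (mdifferentiableAt_chart_symm hy)

theorem chartInvDeriv_transition {p q : M} {y : Plane} (hy : y ∈ (extChartAt (𝓡 2) p).target)
    (hyq : (extChartAt (𝓡 2) p).symm y ∈ (extChartAt (𝓡 2) q).source) (v : Plane) :
    chartInvDeriv p y v = chartInvDeriv q (transition p q y) (fderiv ℝ (transition p q) y v) := by
  rw [fderiv_transition hy hyq, ContinuousLinearMap.comp_apply]
  have := chartInvDeriv_chartDeriv (transition_mem_target hyq) (chartInvDeriv p y v)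
  rw [symm_transition hyq] at this
  exact this.symm

theorem contDiffOn_transition (p q : M) :
    ContDiffOn ℝ ∞ (transition p q) ((extChartAt (𝓡 2) p).target ∩
      (extChartAt (𝓡 2) p).symm ⁻¹' (extChartAt (𝓡 2) q).source) := by
  rw [← contMDiffOn_iff_contDiffOn]
  refine (contMDiffOn_extChartAt (I := 𝓡 2) (x := q) (n := ∞)).comp
    ((contMDiffOn_extChartAt_symm p).mono inter_subset_left) ?_
  intro y hy
  rw [← extChartAt_source (𝓡 2)]
  exact hy.2

theorem contDiffOn_comp_chart_symm {n : ℕ∞} {u : M → ℝ} {U : Set M} (p : M)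
    (hu : ContMDiffOn (𝓡 2) 𝓘(ℝ, ℝ) n u U) :
    ContDiffOn ℝ n (u ∘ (extChartAt (𝓡 2) p).symm)
      ((extChartAt (𝓡 2) p).target ∩ (extChartAt (𝓡 2) p).symm ⁻¹' U) := by
  rw [← contMDiffOn_iff_contDiffOn]
  refine hu.comp ((ContMDiffOn.of_le (contMDiffOn_extChartAt_symm (n := ∞) p) ?_).mono
    inter_subset_left) inter_subset_right
  exact_mod_cast le_top

theorem diffAt_eq_fderiv_chart {u : M → ℝ} {p : M} {y : Plane}
    (hy : y ∈ (extChartAt (𝓡 2) p).target)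
    (hu : MDifferentiableAt (𝓡 2) 𝓘(ℝ, ℝ) u ((extChartAt (𝓡 2) p).symm y)) (v : Plane) :
    diffAt u ((extChartAt (𝓡 2) p).symm y) v =
      fderiv ℝ (u ∘ (extChartAt (𝓡 2) p).symm) y
        (chartDeriv p ((extChartAt (𝓡 2) p).symm y) v) := by
  have h : fderiv ℝ (u ∘ (extChartAt (𝓡 2) p).symm) y =
      diffAt u ((extChartAt (𝓡 2) p).symm y) ∘L chartInvDeriv p y := by
    rw [← mfderiv_eq_fderiv]
    exact mfderiv_comp y hu (mdifferentiableAt_chart_symm hy)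
  rw [h, ContinuousLinearMap.comp_apply, chartInvDeriv_chartDeriv hy]

end

variable [RiemannianBundle (fun x : M => TangentSpace (𝓡 2) x)]

/-- The Riemannian metric at `x`, as a bilinear form on the model plane. -/
def metricAt (x : M) (v w : Plane) : ℝ :=
  @inner ℝ (TangentSpace (𝓡 2) x) _ v w

/-- The tangent space and the model plane have the same underlying vectors but two inner products;
this lemma and the next ones record the algebra of the Riemannian one. -/
theorem metricAt_comm (x : M) (v w : Plane) : metricAt x v w = metricAt x w v :=
  real_inner_comm (F := TangentSpace (𝓡 2) x) w v

theorem metricAt_add_left (x : M) (v v' w : Plane) :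
    metricAt x (v + v') w = metricAt x v w + metricAt x v' w :=
  inner_add_left (E := TangentSpace (𝓡 2) x) (𝕜 := ℝ) v v' w

theorem metricAt_smul_left (x : M) (c : ℝ) (v w : Plane) :
    metricAt x (c • v) w = c * metricAt x v w :=
  real_inner_smul_left (F := TangentSpace (𝓡 2) x) v w c

theorem metricAt_add_right (x : M) (v w w' : Plane) :
    metricAt x v (w + w') = metricAt x v w + metricAt x v w' :=
  inner_add_right (E := TangentSpace (𝓡 2) x) (𝕜 := ℝ) v w w'

theorem metricAt_smul_right (x : M) (c : ℝ) (v w : Plane) :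
    metricAt x v (c • w) = c * metricAt x v w :=
  real_inner_smul_right (F := TangentSpace (𝓡 2) x) v w c

theorem metricAt_self_pos (x : M) {v : Plane} (hv : v ≠ 0) : 0 < metricAt x v v :=
  real_inner_self_pos (F := TangentSpace (𝓡 2) x).2 hv

/-- The coefficients of the metric in the preferred chart at `p`. -/
def metricCoeff (p : M) (i j : Fin 2) (y : Plane) : ℝ :=
  metricAt ((extChartAt (𝓡 2) p).symm y) (chartInvDeriv p y (stdVec i))
    (chartInvDeriv p y (stdVec j))

/-- The Gram determinant of the metric in the preferred chart at `p`. -/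
def metricDet (p : M) (y : Plane) : ℝ :=
  metricCoeff p 0 0 y * metricCoeff p 1 1 y - metricCoeff p 0 1 y * metricCoeff p 0 1 y

theorem metricCoeff_comm (p : M) (i j : Fin 2) (y : Plane) :
    metricCoeff p i j y = metricCoeff p j i y := metricAt_comm _ _ _

theorem volDensity_eq (p : M) (y : Plane) : volDensity p y = √(metricDet p y) := by
  unfold volDensity metricDet
  rw [Matrix.det_fin_two]
  congr 2
  exact congrArg _ (metricCoeff_comm p 1 0 y)

theorem volDensity_nonneg (p : M) (y : Plane) : 0 ≤ volDensity p y := Real.sqrt_nonneg _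

theorem metricAt_chartInvDeriv (p : M) (y v w : Plane) :
    metricAt ((extChartAt (𝓡 2) p).symm y) (chartInvDeriv p y v) (chartInvDeriv p y w) =
      metricCoeff p 0 0 y * (v 0 * w 0) + metricCoeff p 0 1 y * (v 0 * w 1 + v 1 * w 0) +
        metricCoeff p 1 1 y * (v 1 * w 1) := by
  conv_lhs => rw [eq_sum_stdVec v, eq_sum_stdVec w]
  simp only [map_add, map_smul, metricAt_add_left, metricAt_add_right, metricAt_smul_left,
    metricAt_smul_right]
  have := metricCoeff_comm p 1 0 y
  unfold metricCoeff at *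
  rw [this]
  ring

variable [IsManifold (𝓡 2) ∞ M]

theorem metricCoeff_posDef {p : M} {y : Plane} (hy : y ∈ (extChartAt (𝓡 2) p).target) {v : Plane}
    (hv : v ≠ 0) : 0 < metricCoeff p 0 0 y * (v 0 * v 0) + metricCoeff p 0 1 y *
      (v 0 * v 1 + v 1 * v 0) + metricCoeff p 1 1 y * (v 1 * v 1) := by
  rw [← metricAt_chartInvDeriv]
  refine metricAt_self_pos _ fun h => hv ?_
  rw [← chartDeriv_chartInvDeriv hy v, h, map_zero]

theorem metricCoeff_zero_zero_pos {p : M} {y : Plane} (hy : y ∈ (extChartAt (𝓡 2) p).target) :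
    0 < metricCoeff p 0 0 y := by
  have := metricCoeff_posDef hy (v := stdVec 0) (by simp [stdVec])
  simpa [stdVec] using this

theorem metricDet_pos {p : M} {y : Plane} (hy : y ∈ (extChartAt (𝓡 2) p).target) :
    0 < metricDet p y := by
  have h0 := metricCoeff_zero_zero_pos hy
  -- The vector (-g₀₁, g₀₀) has squared length g₀₀ det(g).
  have := metricCoeff_posDef hy
    (v := (-metricCoeff p 0 1 y) • stdVec 0 + metricCoeff p 0 0 y • stdVec 1) (by
      intro h
      have := congrArg (fun v : Plane => v 1) h
      simp [stdVec, h0.ne'] at this)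
  simp [stdVec] at this
  refine (mul_pos_iff_of_pos_left h0).1 ?_
  unfold metricDet
  linarith

theorem volDensity_pos {p : M} {y : Plane} (hy : y ∈ (extChartAt (𝓡 2) p).target) :
    0 < volDensity p y := by
  rw [volDensity_eq]; exact Real.sqrt_pos.2 (metricDet_pos hy)

/-- The Gram matrices of the two charts are related by G ↦ JᵀGJ, with J the Jacobian matrix of the
transition. -/
theorem metricDet_transition {p q : M} {y : Plane} (hy : y ∈ (extChartAt (𝓡 2) p).target)
    (hyq : (extChartAt (𝓡 2) p).symm y ∈ (extChartAt (𝓡 2) q).source) :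
    metricDet p y = (fderiv ℝ (transition p q) y).det ^ 2 * metricDet q (transition p q y) := by
  have h (i j : Fin 2) := metricAt_chartInvDeriv q (transition p q y)
    (fderiv ℝ (transition p q) y (stdVec i)) (fderiv ℝ (transition p q) y (stdVec j))
  simp only [← chartInvDeriv_transition hy hyq, symm_transition hyq] at h
  have h' (i j : Fin 2) : metricCoeff p i j y = _ := h i j
  simp only [metricDet, h', det_eq_stdVec]
  ring

theorem volDensity_transition {p q : M} {y : Plane} (hy : y ∈ (extChartAt (𝓡 2) p).target)
    (hyq : (extChartAt (𝓡 2) p).symm y ∈ (extChartAt (𝓡 2) q).source) :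
    volDensity p y =
      |(fderiv ℝ (transition p q) y).det| * volDensity q (transition p q y) := by
  rw [volDensity_eq, volDensity_eq, metricDet_transition hy hyq, Real.sqrt_mul (sq_nonneg _),
    Real.sqrt_sq_eq_abs]

theorem det_fderiv_transition_ne_zero {p q : M} {y : Plane}
    (hy : y ∈ (extChartAt (𝓡 2) p).target)
    (hyq : (extChartAt (𝓡 2) p).symm y ∈ (extChartAt (𝓡 2) q).source) :
    (fderiv ℝ (transition p q) y).det ≠ 0 := by
  intro h
  have := metricDet_transition hy hyq
  rw [h] at this
  have h2 := metricDet_pos hy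
  rw [this] at h2
  simp at h2

variable [IsContMDiffRiemannianBundle (𝓡 2) ∞ Plane (fun x : M => TangentSpace (𝓡 2) x)]

theorem contDiffOn_metricCoeff (p : M) (i j : Fin 2) :
    ContDiffOn ℝ ∞ (metricCoeff p i j) (extChartAt (𝓡 2) p).target := by
  have hsec (i : Fin 2) : ContMDiffOn 𝓘(ℝ, Plane) ((𝓡 2).prod 𝓘(ℝ, Plane)) ∞
      (fun y => (⟨(extChartAt (𝓡 2) p).symm y, coordVec p y i⟩ : TangentBundle (𝓡 2) M))
      (extChartAt (𝓡 2) p).target := by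
    have h1 : ContMDiffOn 𝓘(ℝ, Plane) 𝓘(ℝ, Plane).tangent ∞
        (fun y : Plane => (⟨y, stdVec i⟩ : TangentBundle 𝓘(ℝ, Plane) Plane))
        (extChartAt (𝓡 2) p).target :=
      contMDiffOn_vectorSpace_iff_contDiffOn.2 contDiffOn_const
    -- The coordinate field is the image of a constant field under the tangent map of the inverse
    -- chart, hence smooth; the smooth metric then gives smooth coefficients.
    have h2 := (contMDiffOn_extChartAt_symm (I := 𝓡 2) (n := ∞) p).contMDiffOn_tangentMapWithin
      (m := ∞) (by simp) (isOpen_chartTarget p).uniqueMDiffOn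
    refine (h2.comp h1 fun y hy => hy).congr fun y hy => ?_
    have : mfderivWithin 𝓘(ℝ, Plane) (𝓡 2) (extChartAt (𝓡 2) p).symm (extChartAt (𝓡 2) p).target y
        = mfderiv 𝓘(ℝ, Plane) (𝓡 2) (extChartAt (𝓡 2) p).symm y :=
      mfderivWithin_of_isOpen (isOpen_chartTarget p) hy
    simp only [Function.comp, tangentMapWithin, this]
    rfl
  rw [← contMDiffOn_iff_contDiffOn]
  exact (hsec i).inner_bundle (hsec j)

theorem contDiffOn_metricDet (p : M) :
    ContDiffOn ℝ ∞ (metricDet p) (extChartAt (𝓡 2) p).target :=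
  ((contDiffOn_metricCoeff p 0 0).mul (contDiffOn_metricCoeff p 1 1)).sub
    ((contDiffOn_metricCoeff p 0 1).mul (contDiffOn_metricCoeff p 0 1))

theorem contDiffOn_volDensity (p : M) :
    ContDiffOn ℝ ∞ (volDensity p) (extChartAt (𝓡 2) p).target := by
  refine ((contDiffOn_metricDet p).sqrt fun y hy => (metricDet_pos hy).ne').congr fun y _ => ?_
  exact volDensity_eq p y

end ChartCalculus

/-! ### The mean curvature operator in local coordinates. -/

section MinimalSurfaceOperator

variable {M : Type*} [TopologicalSpace M] [ChartedSpace Plane M]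

/-- The partial derivatives of `u` in the preferred chart at `p`. -/
def covec (u : M → ℝ) (p : M) (j : Fin 2) (y : Plane) : ℝ :=
  fderiv ℝ (u ∘ (extChartAt (𝓡 2) p).symm) y (stdVec j)

theorem contDiffOn_covec {Ω : Set M} {u : M → ℝ} [IsManifold (𝓡 2) ∞ M]
    (hΩ : IsOpen Ω) (hu : ContMDiffOn (𝓡 2) 𝓘(ℝ, ℝ) 2 u Ω) (p : M) (j : Fin 2) :
    ContDiffOn ℝ 1 (covec u p j) (chartDomain Ω p) := by
  have h : ContDiffOn ℝ 2 (u ∘ (extChartAt (𝓡 2) p).symm) (chartDomain Ω p) :=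
    contDiffOn_comp_chart_symm (n := 2) p hu
  exact (h.fderiv_of_isOpen (m := 1) (isOpen_chartDomain hΩ p) (by norm_num)).clm_apply
    contDiffOn_const

variable [RiemannianBundle (fun x : M => TangentSpace (𝓡 2) x)]

/-- The vector density `√(det g) X` in the preferred chart at `p`. -/
def flux (X : ∀ x : M, TangentSpace (𝓡 2) x) (p : M) (y : Plane) : Plane :=
  volDensity p y • coordComp X p y

theorem divergence_eq_planeDiv (X : ∀ x : M, TangentSpace (𝓡 2) x) (p : M) :
    divergence X p = (volDensity p (extChartAt (𝓡 2) p p))⁻¹ *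
      planeDiv (flux X p) (extChartAt (𝓡 2) p p) := rfl

/-- The coefficients `g^{ij}` of the inverse metric in the preferred chart at `p`. -/
def cometric (p : M) (i j : Fin 2) (y : Plane) : ℝ :=
  (metricDet p y)⁻¹ * !![metricCoeff p 1 1 y, -metricCoeff p 0 1 y;
    -metricCoeff p 0 1 y, metricCoeff p 0 0 y] i j

/-- The squared norm of the gradient of `u` in coordinates. -/
def gradSq (u : M → ℝ) (p : M) (y : Plane) : ℝ :=
  ∑ i, ∑ j, cometric p i j y * (covec u p i y * covec u p j y)

/-- The field `∇u / √(1 + |∇u|²)`. -/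
def normalField (u : M → ℝ) (x : M) : TangentSpace (𝓡 2) x :=
  (√(1 + ‖grad u x‖ ^ 2))⁻¹ • grad u x

theorem meanCurvOp_eq (u : M → ℝ) : meanCurvOp u = divergence (normalField u) := rfl

theorem cometric_comm (p : M) (y : Plane) : cometric p 0 1 y = cometric p 1 0 y := by
  simp [cometric]

theorem metricAt_grad (u : M → ℝ) (x : M) (v : Plane) :
    metricAt x (vecAt (grad u) x) v = diffAt u x v := by
  unfold metricAt vecAt grad
  have : FiniteDimensional ℝ (TangentSpace (𝓡 2) x) :=
    inferInstanceAs (FiniteDimensional ℝ Plane)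
  have : CompleteSpace (TangentSpace (𝓡 2) x) := FiniteDimensional.complete ℝ _
  exact InnerProductSpace.toDual_symm_apply (𝕜 := ℝ) (E := TangentSpace (𝓡 2) x)

variable [IsManifold (𝓡 2) ∞ M]

/-- The vector transforms by the Jacobian matrix and the density by the absolute Jacobian
determinant; this is the Piola relation required by `planeDiv_piola`. -/
theorem fderiv_transition_flux (X : ∀ x : M, TangentSpace (𝓡 2) x) {p q : M} {y : Plane}
    (hy : y ∈ (extChartAt (𝓡 2) p).target)
    (hyq : (extChartAt (𝓡 2) p).symm y ∈ (extChartAt (𝓡 2) q).source) :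
    fderiv ℝ (transition p q) y (flux X p y) =
      |(fderiv ℝ (transition p q) y).det| • flux X q (transition p q y) := by
  rw [flux, flux, map_smul, volDensity_transition hy hyq, mul_smul]
  congr 2
  rw [fderiv_transition hy hyq, ContinuousLinearMap.comp_apply, coordComp_eq, coordComp_eq,
    chartInvDeriv_chartDeriv hy, symm_transition hyq]

/-- The Riemannian divergence can be computed in every chart. -/
theorem divergence_eq_chart {X : ∀ x : M, TangentSpace (𝓡 2) x} {p q : M} {y : Plane}
    (hy : y ∈ (extChartAt (𝓡 2) p).target) (hq : (extChartAt (𝓡 2) p).symm y = q)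
    (hX : DifferentiableAt ℝ (flux X q) (extChartAt (𝓡 2) q q)) :
    divergence X q = (volDensity p y)⁻¹ * planeDiv (flux X p) y := by
  have hyq : (extChartAt (𝓡 2) p).symm y ∈ (extChartAt (𝓡 2) q).source := by
    rw [hq]; exact mem_extChartAt_source q
  have hψy : transition p q y = extChartAt (𝓡 2) q q := congrArg (extChartAt (𝓡 2) q) hq
  have hopen := isOpen_chart_inter p (isOpen_extChartAt_source (I := 𝓡 2) q)
  have hdet := det_fderiv_transition_ne_zero hy hyq
  have hψ : ContDiffAt ℝ 2 (transition p q) y :=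
    ((contDiffOn_transition p q).contDiffAt (hopen.mem_nhds ⟨hy, hyq⟩)).of_le
      (by norm_cast)
  have key := planeDiv_piola hψ (by rwa [hψy]) hdet (Z := flux X q) (Z' := flux X p) (by
    filter_upwards [hopen.mem_nhds ⟨hy, hyq⟩] with x hx
    exact fderiv_transition_flux X hx.1 hx.2)
  rw [divergence_eq_planeDiv, key, volDensity_transition hy hyq, hψy]
  have := abs_pos.2 hdet
  have := volDensity_pos (p := q) (mem_extChartAt_target q)
  field_simp

theorem metricAt_grad_chart {u : M → ℝ} {p : M} {y : Plane}
    (hy : y ∈ (extChartAt (𝓡 2) p).target)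
    (hu : MDifferentiableAt (𝓡 2) 𝓘(ℝ, ℝ) u ((extChartAt (𝓡 2) p).symm y)) (w : Plane) :
    metricAt ((extChartAt (𝓡 2) p).symm y) (vecAt (grad u) ((extChartAt (𝓡 2) p).symm y))
      (chartInvDeriv p y w) = fderiv ℝ (u ∘ (extChartAt (𝓡 2) p).symm) y w := by
  rw [metricAt_grad, diffAt_eq_fderiv_chart hy hu, chartDeriv_chartInvDeriv hy]

/-- The components solve the 2×2 system ∑ᵢ gᵢⱼXⁱ = ∂ⱼu, and `cometric` is the explicit inverse
matrix. -/
theorem coordComp_grad {u : M → ℝ} {p : M} {y : Plane} (hy : y ∈ (extChartAt (𝓡 2) p).target)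
    (hu : MDifferentiableAt (𝓡 2) 𝓘(ℝ, ℝ) u ((extChartAt (𝓡 2) p).symm y)) (i : Fin 2) :
    coordComp (grad u) p y i = ∑ j, cometric p i j y * covec u p j y := by
  have h (j : Fin 2) : metricAt ((extChartAt (𝓡 2) p).symm y)
      (chartInvDeriv p y (coordComp (grad u) p y)) (chartInvDeriv p y (stdVec j)) =
      covec u p j y := by
    rw [coordComp_eq, chartInvDeriv_chartDeriv hy]
    exact metricAt_grad_chart hy hu _
  have h0 := h 0
  have h1 := h 1
  rw [metricAt_chartInvDeriv] at h0 h1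
  simp [stdVec] at h0 h1
  have hd := (metricDet_pos hy).ne'
  fin_cases i
  · simp [cometric, Fin.sum_univ_two]
    rw [← h0, ← h1]
    field_simp
    rw [metricDet]
    ring
  · simp [cometric, Fin.sum_univ_two]
    rw [← h0, ← h1]
    field_simp
    rw [metricDet]
    ring

theorem norm_grad_sq {u : M → ℝ} {p : M} {y : Plane} (hy : y ∈ (extChartAt (𝓡 2) p).target)
    (hu : MDifferentiableAt (𝓡 2) 𝓘(ℝ, ℝ) u ((extChartAt (𝓡 2) p).symm y)) :
    ‖grad u ((extChartAt (𝓡 2) p).symm y)‖ ^ 2 = gradSq u p y := by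
  have h : ‖grad u ((extChartAt (𝓡 2) p).symm y)‖ ^ 2 =
      metricAt ((extChartAt (𝓡 2) p).symm y) (vecAt (grad u) ((extChartAt (𝓡 2) p).symm y))
        (vecAt (grad u) ((extChartAt (𝓡 2) p).symm y)) :=
    (real_inner_self_eq_norm_sq (F := TangentSpace (𝓡 2) ((extChartAt (𝓡 2) p).symm y)) _).symm
  have h2 := metricAt_grad_chart hy hu (coordComp (grad u) p y)
  rw [coordComp_eq, chartInvDeriv_chartDeriv hy, ← coordComp_eq] at h2
  rw [h, h2, eq_sum_stdVec (coordComp (grad u) p y), coordComp_grad hy hu, coordComp_grad hy hu]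
  simp only [gradSq, covec, Fin.sum_univ_two, map_add, map_smul, smul_eq_mul]
  ring

theorem flux_normalField {u : M → ℝ} {p : M} {y : Plane} (hy : y ∈ (extChartAt (𝓡 2) p).target)
    (hu : MDifferentiableAt (𝓡 2) 𝓘(ℝ, ℝ) u ((extChartAt (𝓡 2) p).symm y)) (i : Fin 2) :
    flux (normalField u) p y i = volDensity p y * ((√(1 + gradSq u p y))⁻¹ *
      ∑ j, cometric p i j y * covec u p j y) := by
  rw [← norm_grad_sq hy hu, ← coordComp_grad hy hu]
  have : coordComp (normalField u) p y =
      (√(1 + ‖grad u ((extChartAt (𝓡 2) p).symm y)‖ ^ 2))⁻¹ • coordComp (grad u) p y :=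
    map_smul (chartDeriv p _) _ _
  rw [flux, this]
  simp

theorem gradSq_nonneg {u : M → ℝ} {p : M} {y : Plane} (hy : y ∈ (extChartAt (𝓡 2) p).target)
    (hu : MDifferentiableAt (𝓡 2) 𝓘(ℝ, ℝ) u ((extChartAt (𝓡 2) p).symm y)) :
    0 ≤ gradSq u p y := by
  rw [← norm_grad_sq hy hu]; positivity

theorem cometric_one_one_pos {p : M} {y : Plane} (hy : y ∈ (extChartAt (𝓡 2) p).target) :
    0 < cometric p 1 1 y := by
  have := metricDet_pos hy
  have := metricCoeff_zero_zero_pos hy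
  simp only [cometric, Matrix.of_apply, Matrix.cons_val', Matrix.cons_val_one,
    Matrix.cons_val_fin_one]
  positivity

theorem cometric_det_pos {p : M} {y : Plane} (hy : y ∈ (extChartAt (𝓡 2) p).target) :
    0 < cometric p 0 0 y * cometric p 1 1 y - cometric p 0 1 y ^ 2 := by
  have h := metricDet_pos hy
  have : cometric p 0 0 y * cometric p 1 1 y - cometric p 0 1 y ^ 2 = (metricDet p y)⁻¹ := by
    have hdet : metricDet p y = _ := rfl
    simp [cometric]
    field_simp
    unfold metricDet
    ring
  rw [this]
  positivity

variable {Ω : Set M} {u : M → ℝ}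

theorem sqrt_gradSq_pos (hΩ : IsOpen Ω) (hu : ContMDiffOn (𝓡 2) 𝓘(ℝ, ℝ) 2 u Ω) (p : M) {y : Plane}
    (hy : y ∈ chartDomain Ω p) : 0 < √(1 + gradSq u p y) := by
  have := gradSq_nonneg hy.1 (mdifferentiableAt_of_mem hΩ hu hy.2)
  positivity

variable [IsContMDiffRiemannianBundle (𝓡 2) ∞ Plane (fun x : M => TangentSpace (𝓡 2) x)]

theorem contDiffOn_cometric (p : M) (i j : Fin 2) :
    ContDiffOn ℝ ∞ (cometric p i j) (extChartAt (𝓡 2) p).target := by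
  refine ((contDiffOn_metricDet p).inv fun y hy => (metricDet_pos hy).ne').mul ?_
  have h := contDiffOn_metricCoeff p
  fin_cases i <;> fin_cases j
  · exact h 1 1
  · exact (h 0 1).neg
  · exact (h 0 1).neg
  · exact h 0 0

theorem contDiffOn_cometric_chartDomain (p : M) (i j : Fin 2) :
    ContDiffOn ℝ 1 (cometric p i j) (chartDomain Ω p) :=
  ((contDiffOn_cometric p i j).of_le (by norm_cast)).mono inter_subset_left

theorem contDiffOn_volDensity_chartDomain (p : M) :
    ContDiffOn ℝ 1 (volDensity p) (chartDomain Ω p) :=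
  ((contDiffOn_volDensity p).of_le (by norm_cast)).mono inter_subset_left

theorem contDiffOn_gradSq (hΩ : IsOpen Ω) (hu : ContMDiffOn (𝓡 2) 𝓘(ℝ, ℝ) 2 u Ω) (p : M) :
    ContDiffOn ℝ 1 (gradSq u p) (chartDomain Ω p) :=
  ContDiffOn.sum fun i _ => ContDiffOn.sum fun j _ =>
    (contDiffOn_cometric_chartDomain p i j).mul
      ((contDiffOn_covec hΩ hu p i).mul (contDiffOn_covec hΩ hu p j))

theorem contDiffOn_sqrt_gradSq (hΩ : IsOpen Ω) (hu : ContMDiffOn (𝓡 2) 𝓘(ℝ, ℝ) 2 u Ω) (p : M) :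
    ContDiffOn ℝ 1 (fun y => √(1 + gradSq u p y)) (chartDomain Ω p) := by
  refine (contDiffOn_const.add (contDiffOn_gradSq hΩ hu p)).sqrt fun y hy => ?_
  have := gradSq_nonneg hy.1 (mdifferentiableAt_of_mem hΩ hu hy.2)
  positivity

theorem contDiffOn_flux_normalField (hΩ : IsOpen Ω) (hu : ContMDiffOn (𝓡 2) 𝓘(ℝ, ℝ) 2 u Ω)
    (p : M) : ContDiffOn ℝ 1 (flux (normalField u) p) (chartDomain Ω p) := by
  rw [contDiffOn_piLp]
  intro i
  have : ContDiffOn ℝ 1 (fun y => volDensity p y * ((√(1 + gradSq u p y))⁻¹ *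
      ∑ j, cometric p i j y * covec u p j y)) (chartDomain Ω p) :=
    (contDiffOn_volDensity_chartDomain p).mul
      (((contDiffOn_sqrt_gradSq hΩ hu p).inv fun y hy => (sqrt_gradSq_pos hΩ hu p hy).ne').mul
        (ContDiffOn.sum fun j _ =>
          (contDiffOn_cometric_chartDomain p i j).mul (contDiffOn_covec hΩ hu p j)))
  exact this.congr fun y hy => flux_normalField hy.1 (mdifferentiableAt_of_mem hΩ hu hy.2) i

/-- The mean curvature operator in an arbitrary chart. -/
theorem meanCurvOp_eq_chart (hΩ : IsOpen Ω) (hu : ContMDiffOn (𝓡 2) 𝓘(ℝ, ℝ) 2 u Ω) {p : M}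
    {y : Plane} (hy : y ∈ chartDomain Ω p) :
    meanCurvOp u ((extChartAt (𝓡 2) p).symm y) =
      (volDensity p y)⁻¹ * planeDiv (flux (normalField u) p) y := by
  rw [meanCurvOp_eq]
  refine divergence_eq_chart hy.1 rfl ?_
  refine ((contDiffOn_flux_normalField hΩ hu _).contDiffAt
    ((isOpen_chartDomain hΩ _).mem_nhds ⟨mem_extChartAt_target _, ?_⟩)).differentiableAt (by simp)
  rw [mem_preimage, extChartAt_to_inv]
  exact hy.2

end MinimalSurfaceOperator

/-! ### The difference of two mean curvature operators as a linear elliptic operator. -/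

section Linearization

/-- Expanding div(B∇w) by the product rule: the drift consists of derivatives of `B`, and no zeroth
order term appears. -/
theorem planeDiv_eq_ellOp {B : Fin 2 → Fin 2 → Plane → ℝ} {V : Set Plane} (hV : IsOpen V)
    (hB : ∀ i j, ContDiffOn ℝ 1 (B i j) V) {w : Plane → ℝ} (hw : ContDiffOn ℝ 2 w V)
    {Z : Plane → Plane} (hZ : ∀ y ∈ V, ∀ i, Z y i = ∑ j, B i j y * fderiv ℝ w y (stdVec j))
    {y : Plane} (hy : y ∈ V) :
    planeDiv Z y = ellOp B (fun j y => ∑ i, fderiv ℝ (B i j) y (stdVec i)) w y := by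
  have hd : DifferentiableAt ℝ (fderiv ℝ w) y :=
    ((hw.contDiffAt (hV.mem_nhds hy)).fderiv_right (m := 1) (by norm_num)).differentiableAt
      (by simp)
  have hwd (j : Fin 2) : HasFDerivAt (fun x => fderiv ℝ w x (stdVec j))
      ((fderiv ℝ (fderiv ℝ w) y).flip (stdVec j)) y := by
    simpa using hd.hasFDerivAt.clm_apply (hasFDerivAt_const (stdVec j) y)
  have hBd (i j : Fin 2) : HasFDerivAt (B i j) (fderiv ℝ (B i j) y) y :=
    (((hB i j).contDiffAt (hV.mem_nhds hy)).differentiableAt (by simp)).hasFDerivAt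
  have hev (i : Fin 2) : (fun x => Z x i) =ᶠ[𝓝 y]
      fun x => B i 0 x * fderiv ℝ w x (stdVec 0) + B i 1 x * fderiv ℝ w x (stdVec 1) := by
    filter_upwards [hV.mem_nhds hy] with x hx
    rw [hZ x hx, Fin.sum_univ_two]
  have he (i : Fin 2) : fderiv ℝ (fun x => Z x i) y = _ := (hev i).fderiv_eq.trans
    (((hBd i 0).mul (hwd 0)).add ((hBd i 1).mul (hwd 1))).fderiv
  simp only [planeDiv, ellOp, he, Fin.sum_univ_two, add_apply, smul_apply, smul_eq_mul,
    ContinuousLinearMap.flip_apply]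
  ring

variable {M : Type*} [TopologicalSpace M] [ChartedSpace Plane M]
  [RiemannianBundle (fun x : M => TangentSpace (𝓡 2) x)]

/-- The vector `(∇u + ∇v)^i` in the preferred chart at `p`. -/
def gradSum (u v : M → ℝ) (p : M) (i : Fin 2) (y : Plane) : ℝ :=
  ∑ j, cometric p i j y * (covec u p j y + covec v p j y)

/-- The sum of the area densities of the graphs of `u` and `v`. -/
def areaSum (u v : M → ℝ) (p : M) (y : Plane) : ℝ :=
  √(1 + gradSq u p y) + √(1 + gradSq v p y)

/-- The common positive factor of the coefficients `linCoeff`. -/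
def linFactor (u v : M → ℝ) (p : M) (y : Plane) : ℝ :=
  volDensity p y *
    (2 * (√(1 + gradSq u p y) * √(1 + gradSq v p y) * areaSum u v p y))⁻¹

/-- The coefficients of the linear operator satisfied by the difference of two functions `u` and
`v` when subtracting their mean curvature operators. -/
def linCoeff (u v : M → ℝ) (p : M) (i j : Fin 2) (y : Plane) : ℝ :=
  linFactor u v p y *
    (areaSum u v p y ^ 2 * cometric p i j y - gradSum u v p i y * gradSum u v p j y)

variable [IsManifold (𝓡 2) ∞ M]
variable {Ω : Set M} {u v : M → ℝ}

theorem sq_sqrt_gradSq (hΩ : IsOpen Ω) (hu : ContMDiffOn (𝓡 2) 𝓘(ℝ, ℝ) 2 u Ω) (p : M) {y : Plane}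
    (hy : y ∈ chartDomain Ω p) : √(1 + gradSq u p y) ^ 2 = 1 + gradSq u p y := by
  have := gradSq_nonneg hy.1 (mdifferentiableAt_of_mem hΩ hu hy.2)
  exact Real.sq_sqrt (by positivity)

/-- Write P, Q for the gradients and a, b for the area densities. Then P/a - Q/b = ½(1/a + 1/b)(P -
Q) + ½(1/a - 1/b)(P + Q), and b² - a² = |Q|² - |P|² turns 1/a - 1/b into -⟨P + Q, P - Q⟩/(ab(a +
b)). The coefficients are thus exact, with no integral over intermediate gradients. -/
theorem flux_sub_eq (hΩ : IsOpen Ω) (hu : ContMDiffOn (𝓡 2) 𝓘(ℝ, ℝ) 2 u Ω)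
    (hv : ContMDiffOn (𝓡 2) 𝓘(ℝ, ℝ) 2 v Ω) (p : M) {y : Plane} (hy : y ∈ chartDomain Ω p)
    (i : Fin 2) : flux (normalField u) p y i - flux (normalField v) p y i =
      ∑ j, linCoeff u v p i j y * (covec u p j y - covec v p j y) := by
  rw [flux_normalField hy.1 (mdifferentiableAt_of_mem hΩ hu hy.2),
    flux_normalField hy.1 (mdifferentiableAt_of_mem hΩ hv hy.2)]
  have h1 := sq_sqrt_gradSq hΩ hu p hy
  have h2 := sq_sqrt_gradSq hΩ hv p hy
  have hp1 := sqrt_gradSq_pos hΩ hu p hy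
  have hp2 := sqrt_gradSq_pos hΩ hv p hy
  simp only [linCoeff, linFactor, gradSum, areaSum]
  set a := √(1 + gradSq u p y)
  set b := √(1 + gradSq v p y)
  simp only [gradSq, Fin.sum_univ_two, cometric_comm p y] at *
  have hs : a + b ≠ 0 := by positivity
  field_simp
  linear_combination volDensity p y * (cometric p i 0 y * (covec u p 0 y + covec v p 0 y) +
    cometric p i 1 y * (covec u p 1 y + covec v p 1 y)) * (h2 - h1)

/-- Cauchy–Schwarz for a binary form: the two sides differ by (ac - b²)(xw - yz)². -/
theorem quadratic_le_of_det_pos {a b c : ℝ} (hdet : 0 < a * c - b ^ 2)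
    (x y z w : ℝ) : (a * (x * z) + b * (x * w + y * z) + c * (y * w)) ^ 2 ≤
      (a * (x * x) + b * (x * y + y * x) + c * (y * y)) *
        (a * (z * z) + b * (z * w + w * z) + c * (w * w)) := by
  nlinarith [mul_nonneg hdet.le (sq_nonneg (x * w - y * z))]

theorem quadratic_pos_of_det_pos {a b c : ℝ} (hc : 0 < c) (hdet : 0 < a * c - b ^ 2)
    {ξ : Fin 2 → ℝ} (hξ : ξ ≠ 0) :
    0 < a * (ξ 0 * ξ 0) + b * (ξ 0 * ξ 1 + ξ 1 * ξ 0) + c * (ξ 1 * ξ 1) := by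
  refine (mul_pos_iff_of_pos_left hc).1 ?_
  have e : c * (a * (ξ 0 * ξ 0) + b * (ξ 0 * ξ 1 + ξ 1 * ξ 0) + c * (ξ 1 * ξ 1)) =
      (a * c - b ^ 2) * ξ 0 ^ 2 + (b * ξ 0 + c * ξ 1) ^ 2 := by ring
  rw [e]
  by_cases h0 : ξ 0 = 0
  · have h1 : ξ 1 ≠ 0 := fun h1 => hξ (by ext i; fin_cases i <;> simp [h0, h1])
    rw [h0]
    simp
    positivity
  · have : 0 < (a * c - b ^ 2) * ξ 0 ^ 2 := by positivity
    positivity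

theorem linFactor_pos (hΩ : IsOpen Ω) (hu : ContMDiffOn (𝓡 2) 𝓘(ℝ, ℝ) 2 u Ω)
    (hv : ContMDiffOn (𝓡 2) 𝓘(ℝ, ℝ) 2 v Ω) (p : M) {y : Plane} (hy : y ∈ chartDomain Ω p) :
    0 < linFactor u v p y := by
  have hp1 := sqrt_gradSq_pos hΩ hu p hy
  have hp2 := sqrt_gradSq_pos hΩ hv p hy
  have := volDensity_pos hy.1
  unfold linFactor areaSum
  positivity

/-- Positivity amounts to ⟨ξ, P + Q⟩² < (a + b)²|ξ|² for gradients P, Q and area densities a, b. By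
Cauchy–Schwarz it suffices that |P + Q| < a + b, which follows from a² = 1 + |P|², b² = 1 + |Q|² and
⟨P, Q⟩ < ab. -/
theorem isElliptic_linCoeff (hΩ : IsOpen Ω) (hu : ContMDiffOn (𝓡 2) 𝓘(ℝ, ℝ) 2 u Ω)
    (hv : ContMDiffOn (𝓡 2) 𝓘(ℝ, ℝ) 2 v Ω) (p : M) :
    IsElliptic (linCoeff u v p) (chartDomain Ω p) := by
  refine ⟨fun y hy => ?_, fun y hy ξ hξ => ?_⟩
  · simp only [linCoeff, cometric_comm]; ring
  have h1 := sq_sqrt_gradSq hΩ hu p hy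
  have h2 := sq_sqrt_gradSq hΩ hv p hy
  have hp1 := sqrt_gradSq_pos hΩ hu p hy
  have hp2 := sqrt_gradSq_pos hΩ hv p hy
  have hn1 := gradSq_nonneg hy.1 (mdifferentiableAt_of_mem hΩ hu hy.2)
  have hn2 := gradSq_nonneg hy.1 (mdifferentiableAt_of_mem hΩ hv hy.2)
  have hc := cometric_one_one_pos hy.1
  have hd := cometric_det_pos hy.1
  have hcs := quadratic_le_of_det_pos hd (covec u p 0 y) (covec u p 1 y) (covec v p 0 y)
    (covec v p 1 y)
  have hcs2 := quadratic_le_of_det_pos hd (ξ 0) (ξ 1) (covec u p 0 y + covec v p 0 y)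
    (covec u p 1 y + covec v p 1 y)
  have hpos := quadratic_pos_of_det_pos hc hd hξ
  have hK := linFactor_pos hΩ hu hv p hy
  have hsum : ∑ i, ∑ j, linCoeff u v p i j y * (ξ i * ξ j) = linFactor u v p y *
      (areaSum u v p y ^ 2 * (cometric p 0 0 y * (ξ 0 * ξ 0) + cometric p 0 1 y *
        (ξ 0 * ξ 1 + ξ 1 * ξ 0) + cometric p 1 1 y * (ξ 1 * ξ 1)) -
      (cometric p 0 0 y * (ξ 0 * (covec u p 0 y + covec v p 0 y)) + cometric p 0 1 y *
        (ξ 0 * (covec u p 1 y + covec v p 1 y) + ξ 1 * (covec u p 0 y + covec v p 0 y)) +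
        cometric p 1 1 y * (ξ 1 * (covec u p 1 y + covec v p 1 y))) ^ 2) := by
    simp only [linCoeff, gradSum, Fin.sum_univ_two, ← cometric_comm p y]
    ring
  rw [hsum]
  refine mul_pos hK (sub_pos.2 (hcs2.trans_lt ?_))
  rw [mul_comm]
  refine mul_lt_mul_of_pos_right ?_ hpos
  have e1 : gradSq u p y = cometric p 0 0 y * (covec u p 0 y * covec u p 0 y) + cometric p 0 1 y *
      (covec u p 0 y * covec u p 1 y + covec u p 1 y * covec u p 0 y) +
      cometric p 1 1 y * (covec u p 1 y * covec u p 1 y) := by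
    simp only [gradSq, Fin.sum_univ_two, ← cometric_comm p y]; ring
  have e2 : gradSq v p y = cometric p 0 0 y * (covec v p 0 y * covec v p 0 y) + cometric p 0 1 y *
      (covec v p 0 y * covec v p 1 y + covec v p 1 y * covec v p 0 y) +
      cometric p 1 1 y * (covec v p 1 y * covec v p 1 y) := by
    simp only [gradSq, Fin.sum_univ_two, ← cometric_comm p y]; ring
  rw [← e1, ← e2] at hcs
  unfold areaSum
  set a := √(1 + gradSq u p y)
  set b := √(1 + gradSq v p y)
  set t := cometric p 0 0 y * (covec u p 0 y * covec v p 0 y) + cometric p 0 1 y *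
      (covec u p 0 y * covec v p 1 y + covec u p 1 y * covec v p 0 y) +
      cometric p 1 1 y * (covec u p 1 y * covec v p 1 y) with ht
  have ht2 : t < a * b := by
    refine lt_of_pow_lt_pow_left₀ 2 (by positivity) ?_
    rw [mul_pow, h1, h2]
    nlinarith
  have : cometric p 0 0 y * ((covec u p 0 y + covec v p 0 y) * (covec u p 0 y + covec v p 0 y)) +
      cometric p 0 1 y * ((covec u p 0 y + covec v p 0 y) * (covec u p 1 y + covec v p 1 y) +
        (covec u p 1 y + covec v p 1 y) * (covec u p 0 y + covec v p 0 y)) +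
      cometric p 1 1 y * ((covec u p 1 y + covec v p 1 y) * (covec u p 1 y + covec v p 1 y)) =
      gradSq u p y + gradSq v p y + 2 * t := by
    rw [e1, e2, ht]; ring
  rw [this]
  have : (a + b) ^ 2 = a ^ 2 + b ^ 2 + 2 * (a * b) := by ring
  rw [this, h1, h2]
  linarith

variable [IsContMDiffRiemannianBundle (𝓡 2) ∞ Plane (fun x : M => TangentSpace (𝓡 2) x)]

theorem contDiffOn_linCoeff (hΩ : IsOpen Ω) (hu : ContMDiffOn (𝓡 2) 𝓘(ℝ, ℝ) 2 u Ω)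
    (hv : ContMDiffOn (𝓡 2) 𝓘(ℝ, ℝ) 2 v Ω) (p : M) (i j : Fin 2) :
    ContDiffOn ℝ 1 (linCoeff u v p i j) (chartDomain Ω p) := by
  have ha := contDiffOn_sqrt_gradSq hΩ hu p
  have hb := contDiffOn_sqrt_gradSq hΩ hv p
  have hs (i : Fin 2) : ContDiffOn ℝ 1 (gradSum u v p i) (chartDomain Ω p) :=
    ContDiffOn.sum fun j _ => (contDiffOn_cometric_chartDomain p i j).mul
      ((contDiffOn_covec hΩ hu p j).add (contDiffOn_covec hΩ hv p j))
  have hab : ContDiffOn ℝ 1 (areaSum u v p) (chartDomain Ω p) := ha.add hb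
  refine ContDiffOn.mul ?_ (((hab.pow 2).mul (contDiffOn_cometric_chartDomain p i j)).sub
    ((hs i).mul (hs j)))
  refine (contDiffOn_volDensity_chartDomain p).mul
    ((contDiffOn_const.mul ((ha.mul hb).mul hab)).inv fun y hy => ?_)
  have hp1 := sqrt_gradSq_pos hΩ hu p hy
  have hp2 := sqrt_gradSq_pos hΩ hv p hy
  unfold areaSum
  positivity

/-- **Strong maximum principle**: two solutions of the differential inequality that are ordered
coincide near every contact point. -/
theorem eventually_eq_of_le_of_eq (hΩ : IsOpen Ω) (hu : ContMDiffOn (𝓡 2) 𝓘(ℝ, ℝ) 2 u Ω)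
    (hv : ContMDiffOn (𝓡 2) 𝓘(ℝ, ℝ) 2 v Ω) (hdiv : ∀ x ∈ Ω, meanCurvOp u x ≤ meanCurvOp v x)
    (hle : ∀ x ∈ Ω, v x ≤ u x) {x : M} (hx : x ∈ Ω) (hxe : u x = v x) :
    ∀ᶠ z in 𝓝 x, u z = v z := by
  set e := extChartAt (𝓡 2) x
  set V := chartDomain Ω x with hVdef
  have hV : IsOpen V := isOpen_chartDomain hΩ x
  have hu' : ContDiffOn ℝ 2 (u ∘ e.symm) V := contDiffOn_comp_chart_symm (n := 2) x hu
  have hv' : ContDiffOn ℝ 2 (v ∘ e.symm) V := contDiffOn_comp_chart_symm (n := 2) x hv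
  have hxV : e x ∈ V := ⟨mem_extChartAt_target x, by
    rw [mem_preimage, extChartAt_to_inv]; exact hx⟩
  have hcov : ∀ y ∈ V, ∀ j, fderiv ℝ (fun y => (u ∘ e.symm) y - (v ∘ e.symm) y) y (stdVec j) =
      covec u x j y - covec v x j y := by
    intro y hy j
    have h := (((hu'.contDiffAt (hV.mem_nhds hy)).differentiableAt (by simp)).hasFDerivAt.sub
      ((hv'.contDiffAt (hV.mem_nhds hy)).differentiableAt (by simp)).hasFDerivAt).fderiv
    have h' : fderiv ℝ (fun y => (u ∘ e.symm) y - (v ∘ e.symm) y) y = _ := h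
    rw [h']
    rfl
  have hzero := eventually_eq_zero_of_ellOp_nonpos hV (isElliptic_linCoeff hΩ hu hv x)
    (fun i j => (contDiffOn_linCoeff hΩ hu hv x i j).continuousOn)
    (b := fun j y => ∑ i, fderiv ℝ (linCoeff u v x i j) y (stdVec i))
    (fun j => continuousOn_finsetSum _ fun i _ =>
      ((contDiffOn_linCoeff hΩ hu hv x i j).continuousOn_fderiv_of_isOpen hV
        (by simp)).clm_apply continuousOn_const)
    (w := fun y => (u ∘ e.symm) y - (v ∘ e.symm) y) (hu'.sub hv')
    (fun y hy => sub_nonneg.2 (hle _ hy.2)) (fun y hy => ?_) hxV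
    (by simp [e, hxe])
  · have h1 := (continuousAt_extChartAt (I := 𝓡 2) x).eventually hzero
    filter_upwards [h1, extChartAt_source_mem_nhds (I := 𝓡 2) x] with z hz hzs
    have : e.symm (e z) = z := e.left_inv hzs
    simp only [Function.comp, e] at hz this
    rw [this] at hz
    linarith
  -- The linear operator applied to u - v is the divergence of the difference of fluxes, whose sign
  -- is given by `hdiv` after removing the common positive density.
  · rw [← planeDiv_eq_ellOp hV (contDiffOn_linCoeff hΩ hu hv x) (hu'.sub hv')
      (Z := fun y => flux (normalField u) x y - flux (normalField v) x y) (fun y hy i => by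
        rw [PiLp.sub_apply, flux_sub_eq hΩ hu hv x hy]
        exact Finset.sum_congr rfl fun j _ => by rw [hcov y hy]) hy]
    have hfd {u : M → ℝ} (hu : ContMDiffOn (𝓡 2) 𝓘(ℝ, ℝ) 2 u Ω) :
        DifferentiableAt ℝ (flux (normalField u) x) y :=
      ((contDiffOn_flux_normalField hΩ hu x).contDiffAt (hV.mem_nhds hy)).differentiableAt
        (by simp)
    rw [planeDiv_sub (hfd hu) (hfd hv), sub_nonpos]
    have := hdiv _ hy.2
    rw [meanCurvOp_eq_chart hΩ hu hy, meanCurvOp_eq_chart hΩ hv hy] at this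
    exact le_of_mul_le_mul_left this (inv_pos.2 (volDensity_pos hy.1))

end Linearization

/-! ### The Riemannian area measure, glued from charts. -/

section RiemannianMeasure

open MeasureTheory

variable {M : Type*} [TopologicalSpace M] [ChartedSpace Plane M]
  [RiemannianBundle (fun x : M => TangentSpace (𝓡 2) x)]

theorem aemeasurable_volDensity [IsManifold (𝓡 2) ∞ M]
    [IsContMDiffRiemannianBundle (𝓡 2) ∞ Plane (fun x : M => TangentSpace (𝓡 2) x)] (p : M) :
    AEMeasurable (fun y => (volDensity p y).toNNReal)
    ((volume : Measure Plane).restrict (extChartAt (𝓡 2) p).target) :=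
  ((contDiffOn_volDensity p).continuousOn.aemeasurable
    (isOpen_chartTarget p).measurableSet).real_toNNReal

variable [MeasurableSpace M] [BorelSpace M]

/-- The Riemannian area measure of the domain of the preferred chart at `p`. -/
def chartMeasure (p : M) : Measure M :=
  (((volume : Measure Plane).restrict (extChartAt (𝓡 2) p).target).withDensity
    fun y => ((volDensity p y).toNNReal : ENNReal)).map (extChartAt (𝓡 2) p).symm

/-- Measures which restrict to the Riemannian area measure on the domains of the charts. -/
def IsRiemannianMeasure (μ : Measure M) : Prop :=
  ∀ p : M, μ.restrict (extChartAt (𝓡 2) p).source = chartMeasure p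

section

omit [RiemannianBundle (fun x : M => TangentSpace (𝓡 2) x)]

theorem measurableSet_chart_inter_preimage (p : M) {s : Set M} (hs : MeasurableSet s) :
    MeasurableSet ((extChartAt (𝓡 2) p).target ∩ (extChartAt (𝓡 2) p).symm ⁻¹' s) := by
  have hm : Measurable ((extChartAt (𝓡 2) p).target.domRestrict (extChartAt (𝓡 2) p).symm) :=
    (continuousOn_iff_continuous_domRestrict.1 (continuousOn_extChartAt_symm p)).measurable
  have := MeasurableSet.subtype_image (isOpen_chartTarget p).measurableSet (hm hs)
  convert this using 1
  ext y
  exact ⟨fun h => ⟨⟨y, h.1⟩, h.2, rfl⟩, fun ⟨z, hz, h⟩ => h ▸ ⟨z.2, hz⟩⟩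

theorem aemeasurable_chart_symm (p : M) : AEMeasurable (extChartAt (𝓡 2) p).symm
    ((volume : Measure Plane).restrict (extChartAt (𝓡 2) p).target) :=
  (continuousOn_extChartAt_symm p).aemeasurable (isOpen_chartTarget p).measurableSet

end

theorem chartMeasure_apply (p : M) {s : Set M} (hs : MeasurableSet s) :
    chartMeasure p s = ∫⁻ y in (extChartAt (𝓡 2) p).target ∩ (extChartAt (𝓡 2) p).symm ⁻¹' s,
      ((volDensity p y).toNNReal : ENNReal) := by
  have hae := (aemeasurable_chart_symm p).mono_ac
    (withDensity_absolutelyContinuous _ fun y => ((volDensity p y).toNNReal : ENNReal))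
  rw [chartMeasure, Measure.map_apply_of_aemeasurable hae hs, withDensity_apply',
    Measure.restrict_restrict₀ ((aemeasurable_chart_symm p).nullMeasurable hs), inter_comm]

theorem chartMeasure_source (p : M) {s : Set M} (hs : MeasurableSet s) :
    chartMeasure p (s ∩ (extChartAt (𝓡 2) p).source) = chartMeasure p s := by
  rw [chartMeasure_apply p hs, chartMeasure_apply p
    (hs.inter (isOpen_extChartAt_source p).measurableSet)]
  congr 2
  ext y
  simp only [mem_inter_iff, mem_preimage]
  exact ⟨fun h => ⟨h.1, h.2.1⟩, fun h => ⟨h.1, h.2, (extChartAt (𝓡 2) p).map_target h.1⟩⟩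

variable {μ : Measure M}

theorem IsRiemannianMeasure.apply_eq (hμ : IsRiemannianMeasure μ) (p : M) {s : Set M}
    (hs : MeasurableSet s) (hsp : s ⊆ (extChartAt (𝓡 2) p).source) :
    μ s = ∫⁻ y in (extChartAt (𝓡 2) p).target ∩ (extChartAt (𝓡 2) p).symm ⁻¹' s,
      ((volDensity p y).toNNReal : ENNReal) := by
  rw [← chartMeasure_apply p hs, ← hμ p, Measure.restrict_apply hs, inter_eq_left.2 hsp]

variable [IsManifold (𝓡 2) ∞ M]

/-- Change of variables under the transition map; its absolute Jacobian determinant is exactly the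
ratio of the two densities. -/
theorem chartMeasure_compatible (p q : M) {s : Set M} (hs : MeasurableSet s)
    (hsp : s ⊆ (extChartAt (𝓡 2) p).source) (hsq : s ⊆ (extChartAt (𝓡 2) q).source) :
    chartMeasure p s = chartMeasure q s := by
  rw [chartMeasure_apply p hs, chartMeasure_apply q hs]
  set A := (extChartAt (𝓡 2) p).target ∩ (extChartAt (𝓡 2) p).symm ⁻¹' s with hA
  have hopen := isOpen_chart_inter p (isOpen_extChartAt_source (I := 𝓡 2) q)
  have himage : (extChartAt (𝓡 2) q).target ∩ (extChartAt (𝓡 2) q).symm ⁻¹' s =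
      transition p q '' A := by
    ext z
    constructor
    · rintro ⟨hz, hzs⟩
      refine ⟨extChartAt (𝓡 2) p ((extChartAt (𝓡 2) q).symm z),
        ⟨(extChartAt (𝓡 2) p).map_source (hsp hzs), ?_⟩, ?_⟩
      · rw [mem_preimage, (extChartAt (𝓡 2) p).left_inv (hsp hzs)]; exact hzs
      · rw [transition, Function.comp, (extChartAt (𝓡 2) p).left_inv (hsp hzs),
          (extChartAt (𝓡 2) q).right_inv hz]
    · rintro ⟨y, ⟨hy, hys⟩, rfl⟩
      refine ⟨transition_mem_target (hsq hys), ?_⟩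
      rw [mem_preimage, symm_transition (hsq hys)]
      exact hys
  have hinj : InjOn (transition p q) A := by
    intro y hy z hz h
    have h2 := congrArg (extChartAt (𝓡 2) q).symm h
    rw [symm_transition (hsq hy.2), symm_transition (hsq hz.2)] at h2
    exact (extChartAt (𝓡 2) p).symm.injOn hy.1 hz.1 h2
  have hAm : MeasurableSet A := measurableSet_chart_inter_preimage p hs
  rw [himage, lintegral_image_eq_lintegral_abs_det_fderiv_mul volume hAm
    (f' := fderiv ℝ (transition p q)) (fun y hy =>
      (((contDiffOn_transition p q).contDiffAt (hopen.mem_nhds ⟨hy.1, hsq hy.2⟩)).differentiableAt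
        (by simp)).hasFDerivAt.hasFDerivWithinAt) hinj]
  refine setLIntegral_congr_fun hAm fun y hy => ?_
  change ENNReal.ofReal _ = _ * ENNReal.ofReal _
  rw [← ENNReal.ofReal_mul (abs_nonneg _), volDensity_transition hy.1 (hsq hy.2)]

/-- Countably many chart domains cover `M`. They are made disjoint and each piece carries its own
chart measure; compatibility on overlaps shows that the sum is right in every chart. -/
theorem exists_isRiemannianMeasure [SecondCountableTopology M] [Nonempty M] :
    ∃ μ : Measure M, IsRiemannianMeasure μ := by
  obtain ⟨S, hSc, hS⟩ := countable_cover_nhds fun x : M => extChartAt_source_mem_nhds (I := 𝓡 2) x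
  have hSne : S.Nonempty := by
    by_contra h
    rw [not_nonempty_iff_eq_empty] at h
    simp only [h, mem_empty_iff_false, iUnion_of_empty, iUnion_empty] at hS
    exact empty_ne_univ hS
  obtain ⟨c, hc⟩ := hSc.exists_eq_range hSne
  set U : ℕ → Set M := fun n => (extChartAt (𝓡 2) (c n)).source
  have hU : ⋃ n, U n = univ := by
    rw [← hS, hc, biUnion_range]
  have hUm (n : ℕ) : MeasurableSet (U n) := (isOpen_extChartAt_source (c n)).measurableSet
  have hdm (n : ℕ) : MeasurableSet (disjointed U n) := MeasurableSet.disjointed hUm n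
  refine ⟨Measure.sum fun n => (chartMeasure (c n)).restrict (disjointed U n), fun p => ?_⟩
  have hpm : MeasurableSet (extChartAt (𝓡 2) p).source := (isOpen_extChartAt_source p).measurableSet
  ext s hs
  rw [Measure.restrict_apply hs, Measure.sum_apply _ (hs.inter hpm), ← chartMeasure_source p hs]
  have hterm (n : ℕ) : (chartMeasure (c n)).restrict (disjointed U n)
      (s ∩ (extChartAt (𝓡 2) p).source) =
      chartMeasure p (s ∩ (extChartAt (𝓡 2) p).source ∩ disjointed U n) := by
    rw [Measure.restrict_apply (hs.inter hpm)]
    exact chartMeasure_compatible _ _ ((hs.inter hpm).inter (hdm n))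
      (inter_subset_right.trans (disjointed_subset U n))
      (inter_subset_left.trans inter_subset_right)
  simp_rw [hterm]
  rw [← measure_iUnion (fun i j hij => ((disjoint_disjointed U) hij).mono inter_subset_right
    inter_subset_right) fun n => (hs.inter hpm).inter (hdm n), ← inter_iUnion, iUnion_disjointed,
    hU, inter_univ]

variable [IsContMDiffRiemannianBundle (𝓡 2) ∞ Plane (fun x : M => TangentSpace (𝓡 2) x)]

theorem IsRiemannianMeasure.measure_pos (hμ : IsRiemannianMeasure μ) {U : Set M} (hU : IsOpen U)
    {x : M} (hx : x ∈ U) : 0 < μ U := by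
  set s := U ∩ (extChartAt (𝓡 2) x).source
  have hs : IsOpen s := hU.inter (isOpen_extChartAt_source x)
  refine lt_of_lt_of_le ?_ (measure_mono (inter_subset_left : s ⊆ U))
  rw [hμ.apply_eq x hs.measurableSet inter_subset_right, pos_iff_ne_zero, ne_eq,
    lintegral_eq_zero_iff' (((aemeasurable_volDensity x).coe_nnreal_ennreal).mono_measure
      (Measure.restrict_mono inter_subset_left le_rfl))]
  intro h
  set A := (extChartAt (𝓡 2) x).target ∩ (extChartAt (𝓡 2) x).symm ⁻¹' s
  have hA : IsOpen A := isOpen_chart_inter x hs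
  have hxA : extChartAt (𝓡 2) x x ∈ A := ⟨mem_extChartAt_target x, by
    rw [mem_preimage, extChartAt_to_inv]; exact ⟨hx, mem_extChartAt_source x⟩⟩
  rw [Filter.EventuallyEq, ae_restrict_iff' hA.measurableSet] at h
  have h0 : volume A = 0 := by
    refine measure_mono_null (fun y hy => ?_) h
    simp only [mem_compl_iff, mem_ofPred_eq, Pi.zero_apply]
    intro hc
    have := hc hy
    simp only [ENNReal.coe_eq_zero, Real.toNNReal_eq_zero] at this
    exact (volDensity_pos hy.1).not_ge this
  exact (hA.measure_pos volume ⟨_, hxA⟩).ne' h0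

/-- Integration in a chart. -/
theorem IsRiemannianMeasure.integral_eq (hμ : IsRiemannianMeasure μ) (p : M) {F : M → ℝ}
    {K : Set M} (hK : IsCompact K) (hKp : K ⊆ (extChartAt (𝓡 2) p).source)
    (hF : ∀ x ∉ K, F x = 0)
    (hFc : ContinuousOn (F ∘ (extChartAt (𝓡 2) p).symm) (extChartAt (𝓡 2) p).target) :
    Integrable F μ ∧ ∫ x, F x ∂μ = ∫ y in (extChartAt (𝓡 2) p).target,
      volDensity p y * F ((extChartAt (𝓡 2) p).symm y) := by
  set e := extChartAt (𝓡 2) p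
  have hsm : MeasurableSet e.source := (isOpen_extChartAt_source p).measurableSet
  have htm : MeasurableSet e.target := (isOpen_chartTarget p).measurableSet
  have hF0 : ∀ x, x ∉ e.source → F x = 0 := fun x hx => hF x fun h => hx (hKp h)
  have hcont : ContinuousOn F e.source := by
    refine (hFc.comp (continuousOn_extChartAt p) fun x hx => e.map_source hx).congr fun x hx => ?_
    simp only [Function.comp]
    rw [e.left_inv hx]
  have hsm' : AEStronglyMeasurable F (chartMeasure p) := by
    rw [← hμ p]; exact hcont.aestronglyMeasurable hsm
  have hae := (aemeasurable_chart_symm p).mono_ac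
    (withDensity_absolutelyContinuous _ fun y => ((volDensity p y).toNNReal : ENNReal))
  have heq : ∀ y, (volDensity p y).toNNReal • (F ∘ e.symm) y = volDensity p y * F (e.symm y) :=
    fun y => by
      rw [NNReal.smul_def, Real.coe_toNNReal _ (volDensity_nonneg p y)]; rfl
  have hKc : IsCompact (e '' K) := hK.image_of_continuousOn ((continuousOn_extChartAt p).mono hKp)
  have hKt : e '' K ⊆ e.target := by
    rintro _ ⟨x, hx, rfl⟩; exact e.map_source (hKp hx)
  have hint : Integrable F (chartMeasure p) := by
    rw [chartMeasure, integrable_map_measure hsm' hae,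
      integrable_withDensity_iff_integrable_smul₀ (aemeasurable_volDensity p)]
    refine (integrable_congr (.of_forall heq)).2 ?_
    have h1 : IntegrableOn (fun y => volDensity p y * F (e.symm y)) (e '' K) :=
      (((contDiffOn_volDensity p).continuousOn.mul hFc).mono hKt).integrableOn_compact hKc
    refine IntegrableOn.of_forall_sdiff_eq_zero h1 htm fun y hy => ?_
    rw [hF _ fun h => hy.2 ⟨_, h, e.right_inv hy.1⟩, mul_zero]
  have hint2 : Integrable F μ := by
    rw [← integrableOn_univ]
    refine IntegrableOn.of_forall_sdiff_eq_zero (s := e.source) ?_ MeasurableSet.univ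
      fun x hx => hF0 x hx.2
    rw [IntegrableOn, hμ p]
    exact hint
  refine ⟨hint2, ?_⟩
  rw [← setIntegral_eq_integral_of_forall_compl_eq_zero hF0, hμ p, chartMeasure,
    integral_map hae hsm', integral_withDensity_eq_integral_smul₀ (aemeasurable_volDensity p)]
  exact integral_congr_ae (.of_forall heq)

end RiemannianMeasure

/-! ### The weak form of the differential inequality. -/

section IntegralInequality

open MeasureTheory

section

variable {M : Type*} [TopologicalSpace M] [ChartedSpace Plane M]

theorem diffAt_congr {φ ψ : M → ℝ} {x : M} (h : φ =ᶠ[𝓝 x] ψ) : diffAt φ x = diffAt ψ x :=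
  h.mfderiv_eq

theorem diffAt_const (c : ℝ) (x : M) : diffAt (fun _ => c) x = 0 := mfderiv_const

theorem diffAt_eq_zero_of_notMem [T2Space M] {φ : M → ℝ} {K : Set M} (hK : IsCompact K)
    (h : ∀ x ∉ K, φ x = 0) {x : M} (hx : x ∉ K) : diffAt φ x = 0 := by
  have : φ =ᶠ[𝓝 x] fun _ => 0 := by
    filter_upwards [hK.isClosed.isOpen_compl.mem_nhds hx] with z hz using h z hz
  rw [diffAt_congr this, diffAt_const]

theorem diffAt_sum {ι : Type*} (I : Finset ι) {φ : ι → M → ℝ} {x : M}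
    (h : ∀ i ∈ I, MDifferentiableAt (𝓡 2) 𝓘(ℝ, ℝ) (φ i) x) :
    diffAt (fun x => ∑ i ∈ I, φ i x) x = ∑ i ∈ I, diffAt (φ i) x := by
  suffices HasMFDerivAt (𝓡 2) 𝓘(ℝ, ℝ) (fun x => ∑ i ∈ I, φ i x) x
      (∑ i ∈ I, diffAt (φ i) x : Plane →L[ℝ] ℝ) from this.mfderiv
  induction I using Finset.cons_induction with
  | empty =>
    simp only [Finset.sum_empty]
    exact hasMFDerivAt_const (0 : ℝ) x
  | cons a I ha ih =>
    have := (h a (Finset.mem_cons_self a I)).hasMFDerivAt.add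
      (ih fun i hi => h i (Finset.mem_cons_of_mem hi))
    have hs : (fun x => ∑ i ∈ Finset.cons a I ha, φ i x) = φ a + fun x => ∑ i ∈ I, φ i x :=
      funext fun z => Finset.sum_cons ha
    rw [Finset.sum_cons, hs]
    exact this

theorem diffAt_mul {φ ψ : M → ℝ} {x : M} (hφ : MDifferentiableAt (𝓡 2) 𝓘(ℝ, ℝ) φ x)
    (hψ : MDifferentiableAt (𝓡 2) 𝓘(ℝ, ℝ) ψ x) :
    diffAt (fun x => φ x * ψ x) x = φ x • diffAt ψ x + ψ x • diffAt φ x :=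
  (hφ.hasMFDerivAt.mul hψ.hasMFDerivAt).mfderiv

theorem diffAt_comp {f : ℝ → ℝ} {φ : M → ℝ} {x : M} (hφ : MDifferentiableAt (𝓡 2) 𝓘(ℝ, ℝ) φ x)
    (hf : DifferentiableAt ℝ f (φ x)) :
    diffAt (fun x => f (φ x)) x = deriv f (φ x) • diffAt φ x := by
  have h : diffAt (fun x => f (φ x)) x = fderiv ℝ f (φ x) ∘L diffAt φ x := by
    rw [← mfderiv_eq_fderiv]
    exact mfderiv_comp x hf.mdifferentiableAt hφ
  rw [h]
  ext v
  simp [mul_comm]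

theorem diffAt_sub {φ ψ : M → ℝ} {x : M} (hφ : MDifferentiableAt (𝓡 2) 𝓘(ℝ, ℝ) φ x)
    (hψ : MDifferentiableAt (𝓡 2) 𝓘(ℝ, ℝ) ψ x) :
    diffAt (fun x => φ x - ψ x) x = diffAt φ x - diffAt ψ x :=
  (hφ.hasMFDerivAt.sub hψ.hasMFDerivAt).mfderiv

end

variable {M : Type*} [TopologicalSpace M] [ChartedSpace Plane M]
  [RiemannianBundle (fun x : M => TangentSpace (𝓡 2) x)]

/-- The difference of the fields `∇u / √(1 + |∇u|²)` and `∇v / √(1 + |∇v|²)`. -/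
def fieldDiff (u v : M → ℝ) (x : M) : Plane :=
  vecAt (normalField u) x - vecAt (normalField v) x

theorem volDensity_smul_chartDeriv_fieldDiff (u v : M → ℝ) (p : M) (y : Plane) :
    volDensity p y • chartDeriv p ((extChartAt (𝓡 2) p).symm y)
      (fieldDiff u v ((extChartAt (𝓡 2) p).symm y)) =
      flux (normalField u) p y - flux (normalField v) p y := by
  rw [fieldDiff, map_sub, smul_sub]
  rfl

variable [IsManifold (𝓡 2) ∞ M] [T2Space M]
  [IsContMDiffRiemannianBundle (𝓡 2) ∞ Plane (fun x : M => TangentSpace (𝓡 2) x)]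
  [MeasurableSpace M] [BorelSpace M] {μ : Measure M} {Ω : Set M} {u v : M → ℝ}

/-- The weak form of the differential inequality, for test functions supported in a chart. -/
theorem integral_fieldDiff_nonpos_of_subset_source (hμ : IsRiemannianMeasure μ) (hΩ : IsOpen Ω)
    (hu : ContMDiffOn (𝓡 2) 𝓘(ℝ, ℝ) 2 u Ω) (hv : ContMDiffOn (𝓡 2) 𝓘(ℝ, ℝ) 2 v Ω)
    (hdiv : ∀ x ∈ Ω, meanCurvOp v x ≤ meanCurvOp u x) {Φ : M → ℝ}
    (hΦ : ContMDiff (𝓡 2) 𝓘(ℝ, ℝ) 1 Φ) (hΦ0 : ∀ x, 0 ≤ Φ x) {K : Set M} (hK : IsCompact K)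
    (hKΩ : K ⊆ Ω) (p : M) (hKp : K ⊆ (extChartAt (𝓡 2) p).source) (hΦK : ∀ x ∉ K, Φ x = 0) :
    Integrable (fun x => diffAt Φ x (fieldDiff u v x)) μ ∧
      ∫ x, diffAt Φ x (fieldDiff u v x) ∂μ ≤ 0 := by
  classical
  set e := extChartAt (𝓡 2) p with he
  set V := chartDomain Ω p
  have hV : IsOpen V := isOpen_chartDomain hΩ p
  have hT : IsOpen e.target := isOpen_chartTarget p
  set L : Set Plane := e '' K with hL
  have hLc : IsCompact L := hK.image_of_continuousOn ((continuousOn_extChartAt p).mono hKp)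
  have hLV : L ⊆ V := by
    rintro _ ⟨x, hx, rfl⟩
    refine ⟨e.map_source (hKp hx), ?_⟩
    rw [mem_preimage, e.left_inv (hKp hx)]
    exact hKΩ hx
  -- Extension by zero off the chart image; it stays C¹ because the test function vanishes off the
  -- compact set `K` inside the chart domain.
  set φ : Plane → ℝ := e.target.indicator (Φ ∘ e.symm) with hφdef
  have hφL : ∀ y ∉ L, φ y = 0 := by
    intro y hy
    by_cases hyt : y ∈ e.target
    · rw [hφdef, indicator_of_mem hyt]
      exact hΦK _ fun h => hy ⟨_, h, e.right_inv hyt⟩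
    · exact indicator_of_notMem hyt _
  have hφT : ∀ y ∈ e.target, φ =ᶠ[𝓝 y] Φ ∘ e.symm := fun y hy => by
    filter_upwards [hT.mem_nhds hy] with z hz using indicator_of_mem hz _
  have hφc : ContDiff ℝ 1 φ := by
    refine contDiff_iff_contDiffAt.2 fun y => ?_
    by_cases hy : y ∈ e.target
    · have h1 : ContDiffOn ℝ 1 (Φ ∘ e.symm) (chartDomain univ p) :=
        contDiffOn_comp_chart_symm (n := 1) p hΦ.contMDiffOn
      exact (h1.contDiffAt ((isOpen_chartDomain isOpen_univ p).mem_nhds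
        ⟨hy, mem_univ _⟩)).congr_of_eventuallyEq (hφT y hy)
    · have hyL : y ∉ L := fun h => hy (hLV h).1
      have : φ =ᶠ[𝓝 y] fun _ => 0 := by
        filter_upwards [hLc.isClosed.isOpen_compl.mem_nhds hyL] with z hz using hφL z hz
      exact contDiffAt_const.congr_of_eventuallyEq this
  have hts : tsupport φ ⊆ L := closure_minimal (fun y hy => by
    by_contra h; exact hy (hφL y h)) hLc.isClosed
  have hφcs : HasCompactSupport φ := hLc.of_isClosed_subset (isClosed_tsupport φ) hts
  set Z : Plane → Plane := fun y => flux (normalField u) p y - flux (normalField v) p y with hZ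
  have hZc : ContDiffOn ℝ 1 Z V :=
    (contDiffOn_flux_normalField hΩ hu p).sub (contDiffOn_flux_normalField hΩ hv p)
  have hpt : ∀ y ∈ e.target, volDensity p y * diffAt Φ (e.symm y) (fieldDiff u v (e.symm y)) =
      fderiv ℝ φ y (Z y) := by
    intro y hy
    have h1 := diffAt_eq_fderiv_chart hy (hΦ.mdifferentiableAt (by simp))
      (fieldDiff u v (e.symm y))
    rw [h1, (hφT y hy).fderiv_eq, ← smul_eq_mul, ← map_smul,
      volDensity_smul_chartDeriv_fieldDiff]
  have hcont := continuous_fderiv_apply hV hφc (hts.trans hLV) hZc.continuousOn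
  have hFc : ContinuousOn ((fun x => diffAt Φ x (fieldDiff u v x)) ∘ e.symm) e.target := by
    refine ((hcont.continuousOn (s := e.target)).div
      (contDiffOn_volDensity p).continuousOn fun y hy => (volDensity_pos hy).ne').congr
        fun y hy => ?_
    change diffAt Φ (e.symm y) (fieldDiff u v (e.symm y)) = fderiv ℝ φ y (Z y) / volDensity p y
    rw [← hpt y hy, mul_div_cancel_left₀ _ (volDensity_pos hy).ne']
  obtain ⟨hint, heq⟩ := hμ.integral_eq p hK hKp
    (fun x hx => by rw [diffAt_eq_zero_of_notMem hK hΦK hx, zero_apply]) hFc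
  refine ⟨hint, ?_⟩
  rw [heq, setIntegral_congr_fun hT.measurableSet hpt,
    setIntegral_eq_integral_of_forall_compl_eq_zero,
    integral_fderiv_apply_eq_neg hV hφc hφcs (hts.trans hLV) hZc, neg_nonpos]
  · refine integral_nonneg fun y => ?_
    by_cases hy : y ∈ L
    · have hyV := hLV hy
      refine mul_nonneg ?_ ?_
      · rw [hφdef, indicator_of_mem hyV.1]; exact hΦ0 _
      · have hfd {u : M → ℝ} (hu : ContMDiffOn (𝓡 2) 𝓘(ℝ, ℝ) 2 u Ω) :
            DifferentiableAt ℝ (flux (normalField u) p) y :=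
          ((contDiffOn_flux_normalField hΩ hu p).contDiffAt
            (hV.mem_nhds hyV)).differentiableAt (by simp)
        rw [hZ, planeDiv_sub (hfd hu) (hfd hv), sub_nonneg]
        have := hdiv _ hyV.2
        rw [meanCurvOp_eq_chart hΩ hu hyV, meanCurvOp_eq_chart hΩ hv hyV] at this
        exact le_of_mul_le_mul_left this (inv_pos.2 (volDensity_pos hyV.1))
    · simp [hφL y hy]
  · intro y hy
    have : fderiv ℝ φ y = 0 := image_eq_zero_of_notMem_tsupport
      fun h => hy (hLV (hts (tsupport_fderiv_subset ℝ h))).1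
    simp [this]

/-- The weak form of the differential inequality. -/
theorem integral_fieldDiff_nonpos [SecondCountableTopology M] (hμ : IsRiemannianMeasure μ)
    (hΩ : IsOpen Ω) (hu : ContMDiffOn (𝓡 2) 𝓘(ℝ, ℝ) 2 u Ω) (hv : ContMDiffOn (𝓡 2) 𝓘(ℝ, ℝ) 2 v Ω)
    (hdiv : ∀ x ∈ Ω, meanCurvOp v x ≤ meanCurvOp u x) {Φ : M → ℝ}
    (hΦ : ContMDiff (𝓡 2) 𝓘(ℝ, ℝ) 1 Φ) (hΦ0 : ∀ x, 0 ≤ Φ x) {K : Set M} (hK : IsCompact K)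
    (hKΩ : K ⊆ Ω) (hΦK : ∀ x ∉ K, Φ x = 0) :
    Integrable (fun x => diffAt Φ x (fieldDiff u v x)) μ ∧
      ∫ x, diffAt Φ x (fieldDiff u v x) ∂μ ≤ 0 := by
  have : LocallyCompactSpace M := ChartedSpace.locallyCompactSpace Plane M
  -- Only finitely many members of the partition meet `K`, and they are nonnegative, so each product
  -- is an admissible test function in one chart and the inequalities add up.
  obtain ⟨ρ, hρ⟩ := SmoothPartitionOfUnity.exists_isSubordinate_chartAt_source (𝓡 2) M
  have hfin := ρ.locallyFinite.finite_nonempty_inter_compact hK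
  set I := hfin.toFinset
  have hρΦ (i : M) : ContMDiff (𝓡 2) 𝓘(ℝ, ℝ) 1 fun x => ρ i x * Φ x :=
    ((ρ i).contMDiff.of_le (by norm_cast)).mul hΦ
  have hsum : Φ = fun x => ∑ i ∈ I, ρ i x * Φ x := by
    ext x
    by_cases hx : x ∈ K
    · rw [← Finset.sum_mul, ρ.sum_finsupport' x (mem_univ x), one_mul]
      intro i hi
      rw [ρ.mem_finsupport] at hi
      exact hfin.mem_toFinset.2 ⟨x, hi, hx⟩
    · simp [hΦK x hx]
  have hpiece (i : M) := integral_fieldDiff_nonpos_of_subset_source hμ hΩ hu hv hdiv (hρΦ i)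
    (fun x => mul_nonneg (ρ.nonneg i x) (hΦ0 x)) (hK.inter_right (isClosed_tsupport (ρ i)))
    (inter_subset_left.trans hKΩ) i
    (inter_subset_right.trans (by rw [extChartAt_source]; exact hρ i)) (by
      intro x hx
      by_cases hxK : x ∈ K
      · rw [image_eq_zero_of_notMem_tsupport fun h => hx ⟨hxK, h⟩, zero_mul]
      · rw [hΦK x hxK, mul_zero])
  have hd : (fun x => diffAt Φ x (fieldDiff u v x)) =
      fun x => ∑ i ∈ I, diffAt (fun x => ρ i x * Φ x) x (fieldDiff u v x) := by
    ext x
    conv_lhs => rw [hsum]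
    rw [diffAt_sum I fun i _ => (hρΦ i).mdifferentiableAt (by simp)]
    simp
  rw [hd]
  refine ⟨integrable_finsetSum _ fun i _ => (hpiece i).1, ?_⟩
  rw [integral_finsetSum _ fun i _ => (hpiece i).1]
  exact Finset.sum_nonpos fun i _ => (hpiece i).2

end IntegralInequality

/-! ### Monotonicity and boundedness of the map a ↦ a/√(1+|a|²). -/

section Monotonicity

section

variable {F : Type*} [NormedAddCommGroup F] [InnerProductSpace ℝ F]

/-- The last factor is |N_a - N_b|², where N_a = (a, -1)/√(1+|a|²) is the unit normal of the graph
with gradient `a`. Monotonicity is therefore strict: equal normals have equal last components, hence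
equal gradients. -/
theorem inner_sub_normalized_eq (a b : F) :
    inner ℝ (a - b) ((√(1 + ‖a‖ ^ 2))⁻¹ • a - (√(1 + ‖b‖ ^ 2))⁻¹ • b) =
      (√(1 + ‖a‖ ^ 2) + √(1 + ‖b‖ ^ 2)) / 2 *
        (‖(√(1 + ‖a‖ ^ 2))⁻¹ • a - (√(1 + ‖b‖ ^ 2))⁻¹ • b‖ ^ 2 +
          ((√(1 + ‖a‖ ^ 2))⁻¹ - (√(1 + ‖b‖ ^ 2))⁻¹) ^ 2) := by
  have ha : √(1 + ‖a‖ ^ 2) ^ 2 = 1 + ‖a‖ ^ 2 := Real.sq_sqrt (by positivity)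
  have hb : √(1 + ‖b‖ ^ 2) ^ 2 = 1 + ‖b‖ ^ 2 := Real.sq_sqrt (by positivity)
  have ha0 : 0 < √(1 + ‖a‖ ^ 2) := by positivity
  have hb0 : 0 < √(1 + ‖b‖ ^ 2) := by positivity
  set A := √(1 + ‖a‖ ^ 2)
  set B := √(1 + ‖b‖ ^ 2)
  have ha' : ‖a‖ ^ 2 = A ^ 2 - 1 := by linarith
  have hb' : ‖b‖ ^ 2 = B ^ 2 - 1 := by linarith
  rw [← real_inner_self_eq_norm_sq (A⁻¹ • a - B⁻¹ • b)]
  simp only [inner_sub_left, inner_sub_right, real_inner_smul_left, real_inner_smul_right]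
  simp only [real_inner_self_eq_norm_sq, real_inner_comm a b, ha', hb']
  field_simp
  ring

theorem inner_sub_normalized_nonneg (a b : F) :
    0 ≤ inner ℝ (a - b) ((√(1 + ‖a‖ ^ 2))⁻¹ • a - (√(1 + ‖b‖ ^ 2))⁻¹ • b) := by
  rw [inner_sub_normalized_eq]; positivity

theorem eq_of_inner_sub_normalized_eq_zero {a b : F}
    (h : inner ℝ (a - b) ((√(1 + ‖a‖ ^ 2))⁻¹ • a - (√(1 + ‖b‖ ^ 2))⁻¹ • b) = 0) : a = b := by
  have ha0 : 0 < √(1 + ‖a‖ ^ 2) := by positivity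
  have hb0 : 0 < √(1 + ‖b‖ ^ 2) := by positivity
  rw [inner_sub_normalized_eq, mul_eq_zero, or_iff_right (by positivity)] at h
  have h1 : (√(1 + ‖a‖ ^ 2))⁻¹ = (√(1 + ‖b‖ ^ 2))⁻¹ := by
    rw [← sub_eq_zero, ← sq_eq_zero_iff]
    exact le_antisymm (by nlinarith [sq_nonneg ‖(√(1 + ‖a‖ ^ 2))⁻¹ • a - (√(1 + ‖b‖ ^ 2))⁻¹ • b‖])
      (sq_nonneg _)
  rw [← h1, sub_self, zero_pow two_ne_zero, add_zero, sq_eq_zero_iff, norm_eq_zero, ← smul_sub,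
    smul_eq_zero, or_iff_right (inv_pos.2 ha0).ne', sub_eq_zero] at h
  exact h

theorem norm_normalized_le_one (a : F) : ‖(√(1 + ‖a‖ ^ 2))⁻¹ • a‖ ≤ 1 := by
  have ha0 : 0 < √(1 + ‖a‖ ^ 2) := by positivity
  rw [norm_smul, norm_inv, Real.norm_of_nonneg ha0.le, inv_mul_le_one₀ ha0]
  exact Real.le_sqrt_of_sq_le (by linarith)

end

variable {M : Type*} [TopologicalSpace M] [ChartedSpace Plane M]
  [RiemannianBundle (fun x : M => TangentSpace (𝓡 2) x)]

theorem metricAt_fieldDiff (u v : M → ℝ) (x : M) :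
    metricAt x (vecAt (grad u) x - vecAt (grad v) x) (fieldDiff u v x) =
      diffAt u x (fieldDiff u v x) - diffAt v x (fieldDiff u v x) := by
  rw [← metricAt_grad, ← metricAt_grad]
  exact inner_sub_left (E := TangentSpace (𝓡 2) x) (𝕜 := ℝ) _ _ _

theorem diffAt_sub_fieldDiff_nonneg (u v : M → ℝ) (x : M) :
    0 ≤ diffAt u x (fieldDiff u v x) - diffAt v x (fieldDiff u v x) := by
  rw [← metricAt_fieldDiff]
  exact inner_sub_normalized_nonneg (F := TangentSpace (𝓡 2) x) (grad u x) (grad v x)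

theorem diffAt_eq_of_fieldDiff_eq_zero {u v : M → ℝ} {x : M}
    (h : diffAt u x (fieldDiff u v x) - diffAt v x (fieldDiff u v x) = 0) :
    diffAt u x = diffAt v x := by
  rw [← metricAt_fieldDiff] at h
  have h2 : vecAt (grad u) x = vecAt (grad v) x :=
    eq_of_inner_sub_normalized_eq_zero (F := TangentSpace (𝓡 2) x) h
  ext w
  rw [← metricAt_grad, ← metricAt_grad, h2]

theorem norm_fieldDiff_le (u v : M → ℝ) (x : M) :
    @norm (TangentSpace (𝓡 2) x) _ (fieldDiff u v x) ≤ 2 := by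
  refine (norm_sub_le (E := TangentSpace (𝓡 2) x) (normalField u x) (normalField v x)).trans ?_
  have h1 := norm_normalized_le_one (F := TangentSpace (𝓡 2) x) (grad u x)
  have h2 := norm_normalized_le_one (F := TangentSpace (𝓡 2) x) (grad v x)
  unfold normalField
  linarith

/-- By Cayley–Hamilton, tr(G)⟨Gξ, ξ⟩ - det(G)|ξ|² = |Gξ|² ≥ 0. This bounds the Euclidean length by
the Riemannian one. -/
theorem metricDet_mul_norm_sq_le (p : M) (y ξ : Plane) :
    metricDet p y * ‖ξ‖ ^ 2 ≤ (metricCoeff p 0 0 y + metricCoeff p 1 1 y) *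
      metricAt ((extChartAt (𝓡 2) p).symm y) (chartInvDeriv p y ξ) (chartInvDeriv p y ξ) := by
  rw [metricAt_chartInvDeriv, EuclideanSpace.norm_sq_eq, Fin.sum_univ_two, metricDet]
  simp only [Real.norm_eq_abs, sq_abs]
  nlinarith [sq_nonneg (metricCoeff p 0 0 y * ξ 0 + metricCoeff p 0 1 y * ξ 1),
    sq_nonneg (metricCoeff p 0 1 y * ξ 0 + metricCoeff p 1 1 y * ξ 1)]

variable [IsManifold (𝓡 2) ∞ M]

theorem metricCoeff_one_one_pos {p : M} {y : Plane} (hy : y ∈ (extChartAt (𝓡 2) p).target) :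
    0 < metricCoeff p 1 1 y := by
  have := metricCoeff_posDef hy (v := stdVec 1) (by simp [stdVec])
  simpa [stdVec] using this

variable [IsContMDiffRiemannianBundle (𝓡 2) ∞ Plane (fun x : M => TangentSpace (𝓡 2) x)]

/-- The field has Riemannian length at most 2, so `C` depends on the metric near `p` only and not on
the functions, which may be wild near the exceptional set. -/
theorem eventually_norm_chartDeriv_fieldDiff_le (p : M) :
    ∃ C > 0, ∀ᶠ y in 𝓝 (extChartAt (𝓡 2) p p), ∀ u v : M → ℝ,
      ‖chartDeriv p ((extChartAt (𝓡 2) p).symm y)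
        (fieldDiff u v ((extChartAt (𝓡 2) p).symm y))‖ ≤ C := by
  set h : Plane → ℝ := fun y =>
    (metricDet p y)⁻¹ * ((metricCoeff p 0 0 y + metricCoeff p 1 1 y) * 4) with hdef
  have hT := (isOpen_chartTarget p).mem_nhds (mem_extChartAt_target (I := 𝓡 2) p)
  have hc : ContinuousAt h (extChartAt (𝓡 2) p p) :=
    ContinuousOn.continuousAt (((contDiffOn_metricDet p).continuousOn.inv₀ fun y hy =>
      (metricDet_pos hy).ne').mul (((contDiffOn_metricCoeff p 0 0).continuousOn.add
        (contDiffOn_metricCoeff p 1 1).continuousOn).mul continuousOn_const)) hT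
  -- The estimate bounds the square of the norm by this number; being at least 1, the number is at
  -- most its own square.
  refine ⟨|h (extChartAt (𝓡 2) p p)| + 1, by positivity, ?_⟩
  filter_upwards [hT, hc.eventually_lt_const (lt_of_le_of_lt (le_abs_self _) (lt_add_one _))]
    with y hy hlt u v
  have hd := metricDet_pos hy
  have h1 := metricDet_mul_norm_sq_le p y (chartDeriv p ((extChartAt (𝓡 2) p).symm y)
    (fieldDiff u v ((extChartAt (𝓡 2) p).symm y)))
  rw [chartInvDeriv_chartDeriv hy, ← le_inv_mul_iff₀ hd] at h1
  have h2 : metricAt ((extChartAt (𝓡 2) p).symm y) (fieldDiff u v ((extChartAt (𝓡 2) p).symm y))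
      (fieldDiff u v ((extChartAt (𝓡 2) p).symm y)) ≤ 4 := by
    have := norm_fieldDiff_le u v ((extChartAt (𝓡 2) p).symm y)
    refine (real_inner_self_eq_norm_sq
      (F := TangentSpace (𝓡 2) ((extChartAt (𝓡 2) p).symm y)) _).trans_le ?_
    nlinarith [norm_nonneg (E := TangentSpace (𝓡 2) ((extChartAt (𝓡 2) p).symm y))
      (fieldDiff u v ((extChartAt (𝓡 2) p).symm y))]
  have h3 : ‖chartDeriv p ((extChartAt (𝓡 2) p).symm y)
      (fieldDiff u v ((extChartAt (𝓡 2) p).symm y))‖ ^ 2 ≤ h y := by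
    refine h1.trans ?_
    have := metricCoeff_zero_zero_pos hy
    have := metricCoeff_one_one_pos hy
    rw [hdef]
    dsimp only
    gcongr
  nlinarith [abs_nonneg (h (extChartAt (𝓡 2) p p))]

variable {Ω : Set M} {u v : M → ℝ}

/-- In a chart the pairing is the differential of `φ` applied to the C¹ flux difference, divided by
the area density. -/
theorem continuousAt_diffAt_fieldDiff (hΩ : IsOpen Ω) (hu : ContMDiffOn (𝓡 2) 𝓘(ℝ, ℝ) 2 u Ω)
    (hv : ContMDiffOn (𝓡 2) 𝓘(ℝ, ℝ) 2 v Ω) {φ : M → ℝ}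
    (hφ : ContMDiffOn (𝓡 2) 𝓘(ℝ, ℝ) 2 φ Ω) {p : M} (hp : p ∈ Ω) :
    ContinuousAt (fun x => diffAt φ x (fieldDiff u v x)) p := by
  set e := extChartAt (𝓡 2) p with he
  set Z : Plane → Plane := fun y => flux (normalField u) p y - flux (normalField v) p y with hZ
  have hV : IsOpen (chartDomain Ω p) := isOpen_chartDomain hΩ p
  have hpV : e p ∈ chartDomain Ω p := ⟨mem_extChartAt_target p, by
    rw [mem_preimage, extChartAt_to_inv]; exact hp⟩
  have hZc : ContDiffOn ℝ 1 Z (chartDomain Ω p) :=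
    (contDiffOn_flux_normalField hΩ hu p).sub (contDiffOn_flux_normalField hΩ hv p)
  have hφc : ContDiffOn ℝ 2 (φ ∘ e.symm) (chartDomain Ω p) :=
    contDiffOn_comp_chart_symm (n := 2) p hφ
  have hc : ContinuousOn (fun y => (volDensity p y)⁻¹ * fderiv ℝ (φ ∘ e.symm) y (Z y))
      (chartDomain Ω p) :=
    ((contDiffOn_volDensity_chartDomain p).continuousOn.inv₀ fun y hy =>
      (volDensity_pos hy.1).ne').mul
      ((hφc.continuousOn_fderiv_of_isOpen hV (by norm_num)).clm_apply hZc.continuousOn)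
  have hcp := (hc.continuousAt (hV.mem_nhds hpV)).comp (continuousAt_extChartAt p)
  refine hcp.congr ?_
  filter_upwards [extChartAt_source_mem_nhds (I := 𝓡 2) p, hΩ.mem_nhds hp] with x hx hxΩ
  have hy : e x ∈ e.target := e.map_source hx
  have hxy : e.symm (e x) = x := e.left_inv hx
  have h1 := diffAt_eq_fderiv_chart hy (hxy.symm ▸ mdifferentiableAt_of_mem hΩ hφ hxΩ)
      (fieldDiff u v (e.symm (e x)))
  rw [Function.comp_apply, hZ]
  dsimp only
  rw [← volDensity_smul_chartDeriv_fieldDiff, map_smul, smul_eq_mul,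
    inv_mul_cancel_left₀ (volDensity_pos hy).ne', ← h1, ← he, hxy]

end Monotonicity

/-! ### Cutoff functions: finite sets are negligible for bounded fields. -/

section Cutoff

open MeasureTheory

variable {M : Type*} [TopologicalSpace M] [ChartedSpace Plane M]
  [RiemannianBundle (fun x : M => TangentSpace (𝓡 2) x)]
  [T2Space M] [MeasurableSpace M] [BorelSpace M] {μ : Measure M}

theorem IsRiemannianMeasure.measure_image_le (hμ : IsRiemannianMeasure μ) (p : M) {A : Set Plane}
    (hA : IsCompact A) (hAt : A ⊆ (extChartAt (𝓡 2) p).target) {D : ℝ}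
    (hD : ∀ y ∈ A, volDensity p y ≤ D) :
    μ ((extChartAt (𝓡 2) p).symm '' A) ≤ ENNReal.ofReal D * volume A := by
  set e := extChartAt (𝓡 2) p
  have hs : MeasurableSet (e.symm '' A) :=
    (hA.image_of_continuousOn ((continuousOn_extChartAt_symm p).mono hAt)).isClosed.measurableSet
  rw [hμ.apply_eq p hs (by rintro _ ⟨y, hy, rfl⟩; exact e.map_target (hAt hy))]
  have hsub : e.target ∩ e.symm ⁻¹' (e.symm '' A) ⊆ A := by
    rintro y ⟨hy, z, hz, hzy⟩
    rwa [← e.symm.injOn (hAt hz) hy hzy]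
  rw [← setLIntegral_const]
  refine (lintegral_mono_set hsub).trans (setLIntegral_mono' hA.isClosed.measurableSet ?_)
  exact fun y hy => ENNReal.ofReal_le_ofReal (hD y hy)

variable [IsManifold (𝓡 2) ∞ M]
  [IsContMDiffRiemannianBundle (𝓡 2) ∞ Plane (fun x : M => TangentSpace (𝓡 2) x)]

/-- Points have zero capacity: cutoff functions near a point. -/
theorem exists_cutoff_point (hμ : IsRiemannianMeasure μ) (u v : M → ℝ) (p : M) {W : Set M}
    (hW : W ∈ 𝓝 p) {κ : ℝ} (hκ : 0 < κ) :
    ∃ η b : M → ℝ, ContMDiff (𝓡 2) 𝓘(ℝ, ℝ) ∞ η ∧ (∀ x, 0 ≤ η x) ∧ (∀ x, η x ≤ 1) ∧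
      (∀ᶠ x in 𝓝 p, η x = 0) ∧ (∀ x ∉ W, η x = 1) ∧
      (∀ x, |diffAt η x (fieldDiff u v x)| ≤ b x) ∧ Integrable b μ ∧ ∫ x, b x ∂μ ≤ κ := by
  classical
  set e := extChartAt (𝓡 2) p with he
  set c := e p with hc
  have hT := (isOpen_chartTarget p).mem_nhds (mem_extChartAt_target (I := 𝓡 2) p)
  obtain ⟨C, hC, hCev⟩ := eventually_norm_chartDeriv_fieldDiff_le p
  have hDev : ∀ᶠ y in 𝓝 c, volDensity p y ≤ volDensity p c + 1 :=
    ((contDiffOn_volDensity p).continuousOn.continuousAt hT).eventually_le_const (lt_add_one _)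
  set D := volDensity p c + 1 with hD
  have hD0 : 0 < D := by have := volDensity_nonneg p c; positivity
  have hWev : ∀ᶠ y in 𝓝 c, e.symm y ∈ W := by
    have : Tendsto e.symm (𝓝 c) (𝓝 p) := by
      have := continuousAt_extChartAt_symm (I := 𝓡 2) p
      rwa [ContinuousAt, extChartAt_to_inv] at this
    exact this hW
  obtain ⟨r, hr, hball⟩ := Metric.eventually_nhds_iff_ball.1
    (((hCev.and hDev).and hWev).and (eventually_mem_set.2 hT))
  let χ : ContDiffBump (0 : Plane) := ⟨1, 2, one_pos, one_lt_two⟩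
  have hχ : ContDiff ℝ 1 χ := χ.contDiff (n := 1)
  obtain ⟨B, hB⟩ := (hχ.continuous_fderiv (by simp)).bounded_above_of_compact_support
    (χ.hasCompactSupport.fderiv ℝ)
  have hB0 : 0 ≤ B := (norm_nonneg _).trans (hB 0)
  set m := (volume (Metric.closedBall (0 : Plane) 1)).toReal
  have hm0 : 0 ≤ m := ENNReal.toReal_nonneg
  -- The cutoff has gradient at most B/δ, the field is at most `C`, and the ball of radius 2δ has
  -- area at most 4Dmδ²; the product of the three is 4BCDmδ.
  obtain ⟨δ, hδ, hδr, hδκ⟩ : ∃ δ : ℝ, 0 < δ ∧ 2 * δ < r ∧ 4 * (B * C * D * m) * δ ≤ κ := by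
    refine ⟨min (r / 4) (κ / (4 * (B * C * D * m) + 1)), by positivity, ?_, ?_⟩
    · linarith [min_le_left (r / 4) (κ / (4 * (B * C * D * m) + 1))]
    · refine (mul_le_mul_of_nonneg_left (min_le_right _ _) (by positivity)).trans ?_
      rw [mul_div_assoc', div_le_iff₀ (by positivity)]
      nlinarith
  set A := Metric.closedBall c (2 * δ) with hA
  have hAc : IsCompact A := isCompact_closedBall _ _
  have hAr : ∀ y ∈ A, y ∈ Metric.ball c r := fun y hy => Metric.closedBall_subset_ball hδr hy
  have hAt : A ⊆ e.target := fun y hy => (hball y (hAr y hy)).2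
  set S := e.symm '' A with hS
  have hSc : IsCompact S := hAc.image_of_continuousOn ((continuousOn_extChartAt_symm p).mono hAt)
  set k : Plane → ℝ := fun y => χ (δ⁻¹ • (y - c)) with hk
  have hkc : ContDiff ℝ ∞ k := (χ.contDiff (n := ⊤)).comp
    ((contDiff_id.sub contDiff_const).const_smul δ⁻¹)
  have hk0 : ∀ y ∉ A, k y = 0 := by
    intro y hy
    refine χ.zero_of_le_dist ?_
    rw [hA, Metric.mem_closedBall, not_le, dist_eq_norm] at hy
    rw [dist_zero_right, norm_smul, norm_inv, Real.norm_of_nonneg hδ.le]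
    change 2 ≤ _
    rw [le_inv_mul_iff₀ hδ]
    linarith
  have hk1 : ∀ y ∈ Metric.ball c δ, k y = 1 := by
    intro y hy
    refine χ.one_of_mem_closedBall ?_
    rw [Metric.mem_ball, dist_eq_norm] at hy
    rw [Metric.mem_closedBall, dist_zero_right, norm_smul, norm_inv, Real.norm_of_nonneg hδ.le]
    change _ ≤ 1
    rw [inv_mul_le_iff₀ hδ]
    linarith
  have hkd : ∀ y, ‖fderiv ℝ k y‖ ≤ B * δ⁻¹ := by
    intro y
    have h1 : HasFDerivAt (fun y : Plane => δ⁻¹ • (y - c)) (δ⁻¹ • ContinuousLinearMap.id ℝ Plane)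
        y := ((hasFDerivAt_id y).sub_const c).const_smul δ⁻¹
    have h2 := ((hχ.differentiable (by simp) (δ⁻¹ • (y - c))).hasFDerivAt.comp y h1).fderiv
    have h3 : fderiv ℝ k y = fderiv ℝ χ (δ⁻¹ • (y - c)) ∘L
      (δ⁻¹ • ContinuousLinearMap.id ℝ Plane) := h2
    rw [h3]
    refine (ContinuousLinearMap.opNorm_comp_le _ _).trans (mul_le_mul (hB _) ?_ (norm_nonneg _) hB0)
    rw [norm_smul, norm_inv, Real.norm_of_nonneg hδ.le]
    exact mul_le_of_le_one_right (by positivity) ContinuousLinearMap.norm_id_le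
  set η : M → ℝ := fun x => 1 - e.source.indicator (k ∘ e) x with hη
  have hηs : ∀ x ∈ e.source, η x = 1 - k (e x) := fun x hx => by
    rw [hη]; dsimp only; rw [indicator_of_mem hx]; rfl
  have hηS : ∀ x ∉ S, η x = 1 := by
    intro x hx
    by_cases hxs : x ∈ e.source
    · rw [hηs x hxs, hk0 _ fun h => hx ⟨_, h, e.left_inv hxs⟩, sub_zero]
    · rw [hη]; dsimp only; rw [indicator_of_notMem hxs, sub_zero]
  have hηe : ∀ x ∈ e.source, η =ᶠ[𝓝 x] fun x => 1 - k (e x) := fun x hx => by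
    filter_upwards [(isOpen_extChartAt_source p).mem_nhds hx] with z hz using hηs z hz
  have hηe' : ∀ x ∉ S, η =ᶠ[𝓝 x] fun _ => 1 := fun x hx => by
    filter_upwards [hSc.isClosed.isOpen_compl.mem_nhds hx] with z hz using hηS z hz
  have hSs : S ⊆ e.source := by rintro _ ⟨y, hy, rfl⟩; exact e.map_target (hAt hy)
  have hηc : ContMDiff (𝓡 2) 𝓘(ℝ, ℝ) ∞ η := by
    intro x
    by_cases hx : x ∈ S
    · have hxs := hSs hx
      rw [extChartAt_source] at hxs
      have h1 : ContMDiffAt (𝓡 2) 𝓘(ℝ, Plane) ∞ e x := contMDiffAt_extChartAt' hxs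
      have h2 : ContMDiffAt (𝓡 2) 𝓘(ℝ, ℝ) ∞ (fun x => 1 - k (e x)) x :=
        contMDiffAt_const.sub (hkc.contMDiff.contMDiffAt.comp x h1)
      exact h2.congr_of_eventuallyEq (hηe x (hSs hx))
    · exact contMDiffAt_const.congr_of_eventuallyEq (hηe' x hx)
  -- A constant multiple of an indicator serves as bound, so no measurability of the field itself is
  -- needed.
  refine ⟨η, S.indicator fun _ => B * δ⁻¹ * C, hηc, ?_, ?_, ?_, ?_, ?_, ?_⟩
  · intro x
    by_cases hx : x ∈ S
    · rw [hηs x (hSs hx), sub_nonneg]; exact χ.le_one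
    · rw [hηS x hx]; exact zero_le_one
  · intro x
    by_cases hx : x ∈ S
    · rw [hηs x (hSs hx), sub_le_self_iff]; exact χ.nonneg
    · rw [hηS x hx]
  · filter_upwards [(continuousAt_extChartAt (I := 𝓡 2) p).preimage_mem_nhds
      (Metric.ball_mem_nhds _ hδ), extChartAt_source_mem_nhds (I := 𝓡 2) p] with x hx hxs
    rw [hηs x hxs, hk1 _ hx, sub_self]
  · intro x hx
    refine hηS x ?_
    rintro ⟨y, hy, rfl⟩
    exact hx (hball y (hAr y hy)).1.2
  · intro x
    by_cases hx : x ∈ S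
    · rw [indicator_of_mem hx]
      obtain ⟨y, hy, rfl⟩ := hx
      have hyt := hAt hy
      have h1 := diffAt_eq_fderiv_chart hyt (hηc.mdifferentiableAt (by simp))
        (fieldDiff u v (e.symm y))
      have h2 : η ∘ e.symm =ᶠ[𝓝 y] fun y => 1 - k y := by
        filter_upwards [(isOpen_chartTarget p).mem_nhds hyt] with z hz
        rw [Function.comp_apply, hηs _ (e.map_target hz), e.right_inv hz]
      rw [h1, h2.fderiv_eq, fderiv_const_sub, neg_apply, abs_neg, ← Real.norm_eq_abs]
      exact ContinuousLinearMap.le_of_opNorm_le_of_le _ (hkd y) ((hball y (hAr y hy)).1.1.1 u v)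
    · rw [indicator_of_notMem hx, diffAt_congr (hηe' x hx), diffAt_const, zero_apply, abs_zero]
  · have hμS : μ S ≤ ENNReal.ofReal (D * ((2 * δ) ^ 2 * m)) := by
      refine (hμ.measure_image_le p hAc hAt fun y hy => (hball y (hAr y hy)).1.1.2).trans ?_
      rw [ENNReal.ofReal_mul hD0.le, hA, Measure.addHaar_closedBall' _ _ (by positivity),
        ENNReal.ofReal_mul (by positivity)]
      simp only [m]
      rw [ENNReal.ofReal_toReal (measure_closedBall_lt_top).ne]
      simp
    have hSf : μ S < ⊤ := hμS.trans_lt ENNReal.ofReal_lt_top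
    have hSm : MeasurableSet S := hSc.isClosed.measurableSet
    refine ⟨(integrable_indicator_iff hSm).2 (integrableOn_const hSf.ne), ?_⟩
    rw [integral_indicator hSm, setIntegral_const, smul_eq_mul]
    have h1 : μ.real S ≤ D * ((2 * δ) ^ 2 * m) :=
      ENNReal.toReal_le_of_le_ofReal (by positivity) hμS
    calc μ.real S * (B * δ⁻¹ * C) ≤ D * ((2 * δ) ^ 2 * m) * (B * δ⁻¹ * C) := by gcongr
      _ = 4 * (B * C * D * m) * δ := by field_simp; ring
      _ ≤ κ := hδκ

/-- Finite sets have zero capacity: cutoff functions near a finite set. -/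
theorem exists_cutoff_finite (hμ : IsRiemannianMeasure μ) (u v : M → ℝ) {E : Set M}
    (hE : E.Finite) {W : Set M} (hW : ∀ p ∈ E, W ∈ 𝓝 p) {κ : ℝ} (hκ : 0 < κ) :
    ∃ η b : M → ℝ, ContMDiff (𝓡 2) 𝓘(ℝ, ℝ) ∞ η ∧ (∀ x, 0 ≤ η x) ∧ (∀ x, η x ≤ 1) ∧
      (∀ p ∈ E, ∀ᶠ x in 𝓝 p, η x = 0) ∧ (∀ x ∉ W, η x = 1) ∧
      (∀ x, |diffAt η x (fieldDiff u v x)| ≤ b x) ∧ Integrable b μ ∧ ∫ x, b x ∂μ ≤ κ := by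
  induction E, hE using Set.Finite.induction_on generalizing κ with
  | empty =>
    refine ⟨fun _ => 1, fun _ => 0, contMDiff_const, fun _ => zero_le_one, fun _ => le_rfl, by simp,
      by simp, fun x => ?_, integrable_zero _ _ _, by simpa using hκ.le⟩
    rw [diffAt_const, zero_apply, abs_zero]
  | @insert p E _ _ ih =>
    obtain ⟨η₁, b₁, h1s, h1n, h1l, h1z, h1o, h1d, h1i, h1κ⟩ :=
      exists_cutoff_point hμ u v p (hW p (mem_insert _ _)) (half_pos hκ)
    obtain ⟨η₂, b₂, h2s, h2n, h2l, h2z, h2o, h2d, h2i, h2κ⟩ :=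
      ih (fun q hq => hW q (mem_insert_of_mem _ hq)) (half_pos hκ)
    -- The product vanishes near every point of both sets; as both factors lie in [0, 1], the bounds
    -- on the derivatives add up, each with half of `κ`.
    refine ⟨fun x => η₁ x * η₂ x, fun x => b₁ x + b₂ x, h1s.mul h2s,
      fun x => mul_nonneg (h1n x) (h2n x), fun x => mul_le_one₀ (h1l x) (h2n x) (h2l x), ?_,
      fun x hx => by simp only [h1o x hx, h2o x hx, mul_one], fun x => ?_, h1i.add h2i, ?_⟩
    · rintro q (rfl | hq)
      · exact h1z.mono fun x hx => by simp only [hx, zero_mul]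
      · exact (h2z q hq).mono fun x hx => by simp only [hx, mul_zero]
    · rw [diffAt_mul (h1s.mdifferentiableAt (by simp)) (h2s.mdifferentiableAt (by simp)), add_apply,
        smul_apply, smul_apply, smul_eq_mul, smul_eq_mul, add_comm]
      refine (abs_add_le _ _).trans (add_le_add ?_ ?_)
      · rw [abs_mul, abs_of_nonneg (h2n x)]
        exact (mul_le_of_le_one_left (abs_nonneg _) (h2l x)).trans (h1d x)
      · rw [abs_mul, abs_of_nonneg (h1n x)]
        exact (mul_le_of_le_one_left (abs_nonneg _) (h1l x)).trans (h2d x)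
    · rw [integral_add h1i h2i]
      linarith

end Cutoff

/-! ### The energy estimate and the comparison principle. -/

section MaximumPrinciple

open MeasureTheory

/-- `expNegInvGlue` serves as truncation: smooth, zero on (-∞, 0], strictly increasing afterwards,
and bounded by 1, so that u - v may be unbounded near the exceptional set. -/
theorem deriv_expNegInvGlue_pos {t : ℝ} (ht : 0 < t) : 0 < deriv expNegInvGlue t := by
  have h : expNegInvGlue =ᶠ[𝓝 t] fun s => Real.exp (-s⁻¹) := by
    filter_upwards [lt_mem_nhds ht] with s hs
    simp [expNegInvGlue, not_le.2 hs]
  have h2 : HasDerivAt (fun s : ℝ => Real.exp (-s⁻¹)) (Real.exp (-t⁻¹) * -(-(t ^ 2)⁻¹)) t :=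
    (hasDerivAt_inv ht.ne').neg.exp
  rw [h.deriv_eq, h2.deriv]
  have := Real.exp_pos (-t⁻¹)
  rw [neg_neg]
  positivity

theorem expNegInvGlue_le_one (t : ℝ) : expNegInvGlue t ≤ 1 := by
  unfold expNegInvGlue
  split_ifs with h
  · exact zero_le_one
  · rw [Real.exp_le_one_iff, neg_nonpos, inv_nonneg]
    exact (not_le.1 h).le

theorem _root_.IsPreconnected.forall_of_eventually {X : Type*} [TopologicalSpace X] {s : Set X}
    (hs : IsPreconnected s) {P : X → Prop} {x₀ : X} (hx₀ : x₀ ∈ s) (h₀ : P x₀)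
    (hopen : ∀ x ∈ s, P x → ∀ᶠ z in 𝓝 x, P z) (hclosed : ∀ x ∈ s, ¬P x → ∀ᶠ z in 𝓝 x, ¬P z) :
    ∀ x ∈ s, P x := by
  have hsub : s ⊆ interior {x | P x} := by
    refine hs.subset_left_of_subset_union isOpen_interior
      (isOpen_interior (s := {x | ¬P x})) ?_ ?_ ⟨x₀, hx₀, mem_interior_iff_mem_nhds.2
        (hopen x₀ hx₀ h₀)⟩
    · exact disjoint_left.2 fun x h1 h2 => (interior_subset h2 : ¬P x) (interior_subset h1 : P x)
    · intro x hx
      by_cases h : P x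
      · exact Or.inl (mem_interior_iff_mem_nhds.2 (hopen x hx h))
      · exact Or.inr (mem_interior_iff_mem_nhds.2 (hclosed x hx h))
  exact fun x hx => interior_subset (hsub hx)

theorem eventually_lt_of_zero_le_liminf {X : Type*} {l : Filter X} {u v : X → ℝ}
    (h : 0 ≤ liminf (fun x => ((v x - u x : ℝ) : EReal)) l) {ε : ℝ} (hε : 0 < ε) :
    ∀ᶠ x in l, u x - v x < ε := by
  have h1 : ((-ε : ℝ) : EReal) < liminf (fun x => ((v x - u x : ℝ) : EReal)) l :=
    lt_of_lt_of_le (by exact_mod_cast neg_lt_zero.2 hε) h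
  filter_upwards [eventually_lt_of_lt_liminf h1] with x hx
  have := EReal.coe_lt_coe_iff.1 hx
  linarith

theorem infinite_image_of_isArc {M : Type*} [TopologicalSpace M] {γ : ℝ → M} (hγ : IsArc γ) :
    (γ '' Icc 0 1).Infinite :=
  ((Ico_infinite one_pos).image hγ.2.1).mono (image_mono Ico_subset_Icc_self)

/-- No limit point lies on the frontier: near a frontier point outside `E` the liminf condition
forces u - v < ε, and the points of `E` are removed together with `G`. -/
theorem isCompact_superlevel_diff {X : Type*} [TopologicalSpace X] [T2Space X]
    {Ω E G : Set X} (hcl : IsCompact (closure Ω))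
    {u v : X → ℝ} (hu : ContinuousOn u Ω) (hv : ContinuousOn v Ω) (hΩ : IsOpen Ω)
    (hliminf : ∀ p ∈ frontier Ω \ E,
      0 ≤ liminf (fun x => ((v x - u x : ℝ) : EReal)) (𝓝[Ω] p))
    (hG : IsOpen G) (hEG : E ⊆ G) {ε : ℝ} (hε : 0 < ε) :
    IsCompact ({x ∈ Ω | ε ≤ u x - v x} \ G) := by
  refine hcl.of_isClosed_subset ?_ fun x hx => subset_closure hx.1.1
  refine isClosed_iff_frequently.2 fun x hx => ?_
  have hxG : x ∉ G := fun h => by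
    obtain ⟨z, hz, hzG⟩ := (hx.and_eventually (hG.mem_nhds h)).exists
    exact hz.2 hzG
  have hxcl : x ∈ closure Ω := mem_closure_iff_frequently.2 (hx.mono fun z hz => hz.1.1)
  by_cases hxΩ : x ∈ Ω
  · refine ⟨⟨hxΩ, ?_⟩, hxG⟩
    by_contra! h
    have hc : ContinuousAt (fun x => u x - v x) x :=
      (hu.sub hv).continuousAt (hΩ.mem_nhds hxΩ)
    obtain ⟨z, hz, hzlt⟩ := (hx.and_eventually (hc.eventually_lt_const h)).exists
    exact hzlt.not_ge hz.1.2
  · exfalso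
    have hfr : x ∈ frontier Ω \ E := ⟨⟨hxcl, by rwa [hΩ.interior_eq]⟩, fun h => hxG (hEG h)⟩
    have hev := eventually_nhdsWithin_iff.1 (eventually_lt_of_zero_le_liminf (hliminf x hfr) hε)
    obtain ⟨z, hz, hzlt⟩ := (hx.and_eventually hev).exists
    exact (hzlt hz.1.1).not_ge hz.1.2

variable {M : Type*} [TopologicalSpace M] [ChartedSpace Plane M]

theorem eventually_eq_of_diffAt_eq_zero [IsManifold (𝓡 2) ∞ M] {P : Set M} (hP : IsOpen P)
    {w : M → ℝ} (hw : ∀ x ∈ P, MDifferentiableAt (𝓡 2) 𝓘(ℝ, ℝ) w x)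
    (h0 : ∀ x ∈ P, diffAt w x = 0) {x : M} (hx : x ∈ P) : ∀ᶠ z in 𝓝 x, w z = w x := by
  set e := extChartAt (𝓡 2) x
  have hV : IsOpen (chartDomain P x) := isOpen_chartDomain hP x
  have hxV : e x ∈ chartDomain P x := ⟨mem_extChartAt_target x, by
    rw [mem_preimage, extChartAt_to_inv]; exact hx⟩
  obtain ⟨r, hr, hb⟩ := Metric.isOpen_iff.1 hV _ hxV
  have hd : ∀ y ∈ Metric.ball (e x) r, DifferentiableAt ℝ (w ∘ e.symm) y := fun y hy =>
    mdifferentiableAt_iff_differentiableAt.1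
      ((hw _ (hb hy).2).comp y (mdifferentiableAt_chart_symm (hb hy).1))
  have hz : ∀ y ∈ Metric.ball (e x) r, fderiv ℝ (w ∘ e.symm) y = 0 := by
    intro y hy
    ext v
    have := diffAt_eq_fderiv_chart (hb hy).1 (hw _ (hb hy).2) (chartInvDeriv x y v)
    rw [chartDeriv_chartInvDeriv (hb hy).1, h0 _ (hb hy).2, zero_apply] at this
    rw [← this, zero_apply]
  filter_upwards [(continuousAt_extChartAt (I := 𝓡 2) x).preimage_mem_nhds
    (Metric.ball_mem_nhds _ hr), extChartAt_source_mem_nhds (I := 𝓡 2) x] with z hz' hzs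
  have := Metric.isOpen_ball.is_const_of_fderiv_eq_zero
    (convex_ball (e x) r).isPreconnected (fun y hy => (hd y hy).differentiableWithinAt) hz hz'
    (Metric.mem_ball_self hr)
  rwa [Function.comp_apply, Function.comp_apply, e.left_inv hzs, extChartAt_to_inv] at this

variable [RiemannianBundle (fun x : M => TangentSpace (𝓡 2) x)]

/-- A nonempty frontier contains at least one of its arcs, which is injective on [0, 1). Hence a
finite exceptional set never exhausts the frontier. -/
theorem IsAdmissible.frontier_infinite {Ω : Set M} (hΩ : IsAdmissible Ω) :
    (frontier Ω).Infinite := by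
  obtain ⟨s, r, t, A, B, C, hA, hB, hC, hfr, -, -⟩ := hΩ.frontier_arcs
  obtain ⟨p, hp⟩ := hΩ.frontier_nonempty
  suffices ∃ γ : ℝ → M, IsArc γ ∧ γ '' Icc 0 1 ⊆ frontier Ω by
    obtain ⟨γ, hγ, hsub⟩ := this
    exact (infinite_image_of_isArc hγ).mono hsub
  rw [hfr] at hp ⊢
  rcases hp with (hp | hp) | hp <;> obtain ⟨i, -⟩ := mem_iUnion.1 hp
  · exact ⟨A i, (hA i).1, (subset_iUnion (fun i => A i '' Icc 0 1) i).trans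
      (subset_union_left.trans subset_union_left)⟩
  · exact ⟨B i, (hB i).1, (subset_iUnion (fun i => B i '' Icc 0 1) i).trans
      (subset_union_right.trans subset_union_left)⟩
  · exact ⟨C i, (hC i).1, (subset_iUnion (fun i => C i '' Icc 0 1) i).trans subset_union_right⟩

variable [IsManifold (𝓡 2) ∞ M] [T2Space M] [SecondCountableTopology M]
  [IsContMDiffRiemannianBundle (𝓡 2) ∞ Plane (fun x : M => TangentSpace (𝓡 2) x)]
  {Ω E : Set M} {u v : M → ℝ}

section

variable [MeasurableSpace M] [BorelSpace M] {μ : Measure M}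

/-- The energy estimate: the weak inequality tested with `η f(u - v)`, where `f` vanishes on
`(-∞, ε]` and `η` is a cutoff function near the exceptional set. -/
theorem exists_integrable_lower_bound (hμ : IsRiemannianMeasure μ) (hΩ : IsOpen Ω)
    (hcl : IsCompact (closure Ω)) (hu : ContMDiffOn (𝓡 2) 𝓘(ℝ, ℝ) 2 u Ω)
    (hv : ContMDiffOn (𝓡 2) 𝓘(ℝ, ℝ) 2 v Ω)
    (hdiv : ∀ x ∈ Ω, meanCurvOp v x ≤ meanCurvOp u x) (hE : E.Finite)
    (hliminf : ∀ p ∈ frontier Ω \ E,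
      0 ≤ liminf (fun x => ((v x - u x : ℝ) : EReal)) (𝓝[Ω] p))
    {W : Set M} (hW : ∀ p ∈ E, W ∈ 𝓝 p) {ε κ : ℝ} (hε : 0 < ε) (hκ : 0 < κ) :
    ∃ F : M → ℝ, Integrable F μ ∧ ∫ x, F x ∂μ ≤ κ ∧ (∀ x, 0 ≤ F x) ∧
      ∀ x ∈ Ω, x ∉ W → deriv expNegInvGlue (u x - v x - ε) *
        (diffAt u x (fieldDiff u v x) - diffAt v x (fieldDiff u v x)) ≤ F x := by
  classical
  obtain ⟨η, b, hηs, hη0, -, hηE, hηW, hηd, hbi, hbκ⟩ := exists_cutoff_finite hμ u v hE hW hκ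
  set w : M → ℝ := fun x => u x - v x with hw
  set f : ℝ → ℝ := fun t => expNegInvGlue (t - ε) with hf
  have hfc : ContDiff ℝ 1 f :=
    (expNegInvGlue.contDiff (n := 1)).comp (contDiff_id.sub contDiff_const)
  have hfd (t : ℝ) : deriv f t = deriv expNegInvGlue (t - ε) := deriv_comp_sub_const _ _ _
  set G := interior {x | η x = 0} with hG
  have hEG : E ⊆ G := fun p hp => mem_interior_iff_mem_nhds.2 (hηE p hp)
  set K := {x ∈ Ω | ε ≤ u x - v x} \ G with hK
  have hKc : IsCompact K := isCompact_superlevel_diff hcl hu.continuousOn hv.continuousOn hΩ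
    hliminf isOpen_interior hEG hε
  have hKΩ : K ⊆ Ω := fun x hx => hx.1.1
  -- Off `K` either `η` vanishes or w < ε, so extension by zero gives a global C¹ function.
  set Φ : M → ℝ := Ω.indicator fun x => η x * f (w x) with hΦ
  have hΦK : ∀ x ∉ K, Φ x = 0 := by
    intro x hx
    by_cases hxΩ : x ∈ Ω
    · rw [hΦ, indicator_of_mem hxΩ]
      by_cases hxG : x ∈ G
      · rw [show η x = 0 from interior_subset (s := {x | η x = 0}) hxG, zero_mul]
      · have : f (w x) = 0 := by
          refine expNegInvGlue.zero_of_nonpos (sub_nonpos.2 ?_)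
          by_contra! h
          exact hx ⟨⟨hxΩ, h.le⟩, hxG⟩
        rw [this, mul_zero]
    · exact indicator_of_notMem hxΩ _
  have hΦΩ : ∀ x ∈ Ω, Φ =ᶠ[𝓝 x] fun x => η x * f (w x) := fun x hx => by
    filter_upwards [hΩ.mem_nhds hx] with z hz using indicator_of_mem hz _
  have hwc : ∀ x ∈ Ω, ContMDiffAt (𝓡 2) 𝓘(ℝ, ℝ) 1 w x := fun x hx =>
    (((hu.contMDiffAt (hΩ.mem_nhds hx)).sub (hv.contMDiffAt (hΩ.mem_nhds hx)))).of_le (by norm_num)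
  have hfw : ∀ x ∈ Ω, ContMDiffAt (𝓡 2) 𝓘(ℝ, ℝ) 1 (fun x => f (w x)) x := fun x hx =>
    hfc.contMDiff.contMDiffAt.comp x (hwc x hx)
  have hη1c : ContMDiff (𝓡 2) 𝓘(ℝ, ℝ) 1 η := hηs.of_le (by norm_cast)
  have hΦc : ContMDiff (𝓡 2) 𝓘(ℝ, ℝ) 1 Φ := by
    intro x
    by_cases hx : x ∈ Ω
    · exact (hη1c.contMDiffAt.mul (hfw x hx)).congr_of_eventuallyEq (hΦΩ x hx)
    · have : Φ =ᶠ[𝓝 x] fun _ => 0 := by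
        filter_upwards [hKc.isClosed.isOpen_compl.mem_nhds fun h => hx (hKΩ h)] with z hz
          using hΦK z hz
      exact contMDiffAt_const.congr_of_eventuallyEq this
  have hΦ0 : ∀ x, 0 ≤ Φ x := fun x =>
    indicator_nonneg (fun x _ => mul_nonneg (hη0 x) (expNegInvGlue.nonneg _)) x
  obtain ⟨hint, hle⟩ := integral_fieldDiff_nonpos hμ hΩ hu hv hdiv hΦc hΦ0 hKc hKΩ hΦK
  -- Product and chain rule: dΦ(X) = η f'(w) dw(X) + f(w) dη(X), where the last term is at least
  -- `-b` because 0 ≤ f ≤ 1.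
  have hlow : ∀ x ∈ Ω, η x * (deriv expNegInvGlue (u x - v x - ε) *
      (diffAt u x (fieldDiff u v x) - diffAt v x (fieldDiff u v x))) ≤
      diffAt Φ x (fieldDiff u v x) + b x := by
    intro x hx
    have hwd := (hwc x hx).mdifferentiableAt (by simp)
    rw [diffAt_congr (hΦΩ x hx), diffAt_mul (hη1c.mdifferentiableAt (by simp))
      ((hfw x hx).mdifferentiableAt (by simp)), diffAt_comp hwd
      (hfc.differentiable (by simp) _), hfd, hw, diffAt_sub (mdifferentiableAt_of_mem hΩ hu hx)
      (mdifferentiableAt_of_mem hΩ hv hx)]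
    simp only [add_apply, smul_apply, sub_apply, smul_eq_mul]
    have h1 : |f (w x) * diffAt η x (fieldDiff u v x)| ≤ b x := by
      rw [abs_mul, abs_of_nonneg (expNegInvGlue.nonneg _)]
      exact (mul_le_of_le_one_left (abs_nonneg _) (expNegInvGlue_le_one _)).trans (hηd x)
    have h2 := (abs_le.1 h1).1
    linarith
  refine ⟨fun x => diffAt Φ x (fieldDiff u v x) + b x, hint.add hbi, ?_, fun x => ?_,
    fun x hx hxW => ?_⟩
  · rw [integral_add hint hbi]
    linarith
  · by_cases hx : x ∈ Ω
    · refine (mul_nonneg (hη0 x) (mul_nonneg ?_ (diffAt_sub_fieldDiff_nonneg u v x))).trans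
        (hlow x hx)
      exact expNegInvGlue.monotone.deriv_nonneg
    · dsimp only
      rw [diffAt_eq_zero_of_notMem hKc hΦK fun h => hx (hKΩ h), zero_apply, zero_add]
      exact (abs_nonneg _).trans (hηd x)
  · have := hlow x hx
    rwa [hηW x hxW, one_mul] at this

end

/-- If the differentials differed at `x`, the energy density `g` would exceed a constant c > 0 on a
neighbourhood of `x` where the cutoffs equal 1, while the energy estimate bounds its integral by
every κ > 0. -/
theorem diffAt_eq_of_pos (hΩ : IsOpen Ω)
    (hcl : IsCompact (closure Ω)) (hu : ContMDiffOn (𝓡 2) 𝓘(ℝ, ℝ) 2 u Ω)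
    (hv : ContMDiffOn (𝓡 2) 𝓘(ℝ, ℝ) 2 v Ω)
    (hdiv : ∀ x ∈ Ω, meanCurvOp v x ≤ meanCurvOp u x) (hE : E.Finite) (hEΩ : E ⊆ frontier Ω)
    (hliminf : ∀ p ∈ frontier Ω \ E,
      0 ≤ liminf (fun x => ((v x - u x : ℝ) : EReal)) (𝓝[Ω] p))
    {x : M} (hx : x ∈ Ω) (hpos : 0 < u x - v x) : diffAt u x = diffAt v x := by
  let _ : MeasurableSpace M := borel M
  have : BorelSpace M := ⟨rfl⟩
  have : Nonempty M := ⟨x⟩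
  obtain ⟨μ, hμ⟩ := exists_isRiemannianMeasure (M := M)
  by_contra hne
  -- With this truncation level the difference exceeds `ε` at `x`, so the derivative of the
  -- truncation is positive there.
  set ε := (u x - v x) / 2 with hε
  have hε0 : 0 < ε := by positivity
  set g : M → ℝ := fun z => deriv expNegInvGlue (u z - v z - ε) *
    (diffAt u z (fieldDiff u v z) - diffAt v z (fieldDiff u v z)) with hg
  have hgx : 0 < g x := by
    refine mul_pos (deriv_expNegInvGlue_pos (by linarith)) ?_
    exact (diffAt_sub_fieldDiff_nonneg u v x).lt_of_ne
      fun h => hne (diffAt_eq_of_fieldDiff_eq_zero h.symm)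
  have hgc : ContinuousAt g x := by
    have h1 : Continuous (deriv expNegInvGlue) :=
      (expNegInvGlue.contDiff (n := 1)).continuous_deriv le_rfl
    exact (h1.continuousAt.comp (((hu.continuousOn.sub hv.continuousOn).continuousAt
      (hΩ.mem_nhds hx)).sub continuousAt_const)).mul
      ((continuousAt_diffAt_fieldDiff hΩ hu hv hu hx).sub
        (continuousAt_diffAt_fieldDiff hΩ hu hv hv hx))
  have hxE : x ∉ E := fun h => (hEΩ h).2 (by rwa [hΩ.interior_eq])
  obtain ⟨W, N, hW, hN, hEW, hxN, hWN⟩ := SeparatedNhds.of_isCompact_isCompact hE.isCompact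
    (isCompact_singleton (x := x)) (disjoint_singleton_right.2 hxE)
  set c := g x / 2 with hc
  have hc0 : 0 < c := half_pos hgx
  obtain ⟨N', hN'sub, hN', hxN'⟩ := eventually_nhds_iff.1 (((hgc.eventually_const_lt
    (half_lt_self hgx)).and (hΩ.mem_nhds hx)).and (hN.mem_nhds (hxN rfl)))
  have hμN := hμ.measure_pos hN' hxN'
  have key : ∀ κ > 0, μ N' < ⊤ ∧ c * μ.real N' ≤ κ := by
    intro κ hκ
    obtain ⟨F, hFi, hFκ, hF0, hFg⟩ := exists_integrable_lower_bound hμ hΩ hcl hu hv hdiv hE hliminf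
      (fun p hp => hW.mem_nhds (hEW hp)) hε0 hκ
    -- Markov's inequality for `F` then bounds c times the measure of `N'` by `κ`.
    have hsub : N' ⊆ {z | c ≤ F z} := fun z hz => by
      obtain ⟨⟨h1, h2⟩, h3⟩ := hN'sub z hz
      exact h1.le.trans (hFg z h2 fun h => disjoint_left.1 hWN h h3)
    have hfin := hFi.measure_ge_lt_top hc0
    refine ⟨(measure_mono hsub).trans_lt hfin, ?_⟩
    refine (mul_le_mul_of_nonneg_left (measureReal_mono hsub hfin.ne) hc0.le).trans ?_
    exact (mul_meas_ge_le_integral_of_nonneg (.of_forall hF0) hFi c).trans hFκ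
  have h1 : c * μ.real N' ≤ 0 := le_of_forall_pos_le_add fun κ hκ => by
    rw [zero_add]; exact (key κ hκ).2
  have h2 : 0 < μ.real N' := ENNReal.toReal_pos hμN.ne' (key 1 one_pos).1.ne
  exact (mul_pos hc0 h2).not_ge h1

/-- The weak maximum principle. -/
theorem le_of_liminf_nonneg (hΩ : IsOpen Ω) (hconn : IsPreconnected Ω)
    (hcl : IsCompact (closure Ω)) (hfr : (frontier Ω).Infinite)
    (hu : ContMDiffOn (𝓡 2) 𝓘(ℝ, ℝ) 2 u Ω) (hv : ContMDiffOn (𝓡 2) 𝓘(ℝ, ℝ) 2 v Ω)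
    (hdiv : ∀ x ∈ Ω, meanCurvOp v x ≤ meanCurvOp u x) (hE : E.Finite) (hEΩ : E ⊆ frontier Ω)
    (hliminf : ∀ p ∈ frontier Ω \ E,
      0 ≤ liminf (fun x => ((v x - u x : ℝ) : EReal)) (𝓝[Ω] p)) :
    ∀ x ∈ Ω, u x ≤ v x := by
  intro x₀ hx₀
  by_contra! hlt
  set w : M → ℝ := fun x => u x - v x with hw
  have hwc : ContinuousOn w Ω := hu.continuousOn.sub hv.continuousOn
  have hpos : 0 < w x₀ := sub_pos.2 hlt
  have hP : IsOpen (Ω ∩ w ⁻¹' Ioi 0) := hwc.isOpen_inter_preimage hΩ isOpen_Ioi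
  -- The level set of `w x₀` lies in the open set where w > 0; there dw = 0, so the level set is
  -- open, and by continuity it is closed in `Ω`.
  have hconst : ∀ x ∈ Ω, w x = w x₀ := by
    refine hconn.forall_of_eventually hx₀ rfl (fun x hx hxw => ?_) fun x hx hxw =>
      (hwc.continuousAt (hΩ.mem_nhds hx)).eventually_ne hxw
    rw [← hxw]
    refine eventually_eq_of_diffAt_eq_zero (w := w) hP
      (fun z hz => (mdifferentiableAt_of_mem hΩ hu hz.1).sub
      (mdifferentiableAt_of_mem hΩ hv hz.1)) (fun z hz => ?_) ⟨hx, by simpa [hxw] using hpos⟩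
    rw [hw, diffAt_sub (mdifferentiableAt_of_mem hΩ hu hz.1) (mdifferentiableAt_of_mem hΩ hv hz.1),
      diffAt_eq_of_pos hΩ hcl hu hv hdiv hE hEΩ hliminf hz.1 hz.2, sub_self]
  obtain ⟨p, hp⟩ := (hfr.sdiff hE).nonempty
  have : (𝓝[Ω] p).NeBot := mem_closure_iff_nhdsWithin_neBot.1 hp.1.1
  obtain ⟨z, hz, hzΩ⟩ := ((eventually_lt_of_zero_le_liminf (hliminf p hp) hpos).and
    self_mem_nhdsWithin).exists
  exact hz.ne (hconst z hzΩ)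

end MaximumPrinciple
end MeanCurv

end

theorem proposition4p5
    {M : Type*} [TopologicalSpace M] [T2Space M] [SecondCountableTopology M]
    [ChartedSpace MeanCurv.Plane M] [IsManifold (𝓡 2) ∞ M]
    [RiemannianBundle (fun x : M => TangentSpace (𝓡 2) x)]
    [IsContMDiffRiemannianBundle (𝓡 2) ∞ MeanCurv.Plane (fun x : M => TangentSpace (𝓡 2) x)]
    (Ω : Set M) (hΩ : MeanCurv.IsAdmissible Ω)
    (u₁ u₂ : M → ℝ)
    (hu₁ : ContMDiffOn (𝓡 2) 𝓘(ℝ, ℝ) 2 u₁ Ω)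
    (hu₂ : ContMDiffOn (𝓡 2) 𝓘(ℝ, ℝ) 2 u₂ Ω)
    (hdiv : ∀ x ∈ Ω, MeanCurv.meanCurvOp u₂ x ≤ MeanCurv.meanCurvOp u₁ x)
    (E : Set M) (hE : E.Finite) (hEΩ : E ⊆ frontier Ω)
    (hliminf : ∀ p ∈ frontier Ω \ E,
      0 ≤ liminf (fun x => ((u₂ x - u₁ x : ℝ) : EReal)) (𝓝[Ω] p)) :
    (∀ x ∈ Ω, u₁ x ≤ u₂ x) ∧ ((∀ x ∈ Ω, u₁ x < u₂ x) ∨ (∀ x ∈ Ω, u₁ x = u₂ x)) := by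
  have hle := MeanCurv.le_of_liminf_nonneg hΩ.isOpen hΩ.isConnected.isPreconnected
    hΩ.isCompact_closure hΩ.frontier_infinite hu₁ hu₂ hdiv hE hEΩ hliminf
  refine ⟨hle, ?_⟩
  by_cases h : ∀ x ∈ Ω, u₁ x < u₂ x
  · exact Or.inl h
  push Not at h
  obtain ⟨x₀, hx₀, hx₀le⟩ := h
  -- The contact set is open by the strong maximum principle, applied with `u₂` as the upper
  -- function, and closed by continuity.
  refine Or.inr (hΩ.isConnected.isPreconnected.forall_of_eventually hx₀
    (le_antisymm (hle x₀ hx₀) hx₀le) (fun x hx hxe => ?_) fun x hx hxne => ?_)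
  · exact (MeanCurv.eventually_eq_of_le_of_eq hΩ.isOpen hu₂ hu₁ hdiv hle hx hxe.symm).mono
      fun z hz => hz.symm
  · have hc := ((hu₁.continuousOn.continuousAt (hΩ.isOpen.mem_nhds hx)).sub
      (hu₂.continuousOn.continuousAt (hΩ.isOpen.mem_nhds hx))).eventually_ne (sub_ne_zero.2 hxne)
    exact hc.mono fun z hz => sub_ne_zero.1 hz
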